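/- Let $r=(r_1,\dots,r_t)$ be a tuple of non-negative integers. A finite structure of type $r$ is a tuple $\mathcal A=(A,R_1,\dots,R_t)$ with $A$ a finite set and $R_i\subseteq A^{r_i}$. A minimization problem $\mathcal Q$ on such structures assigns to each $\mathcal A$ a set of feasible solutions with costs in $\mathbb N$, and $\mathrm{opt}_{\mathcal Q}(\mathcal A)$ is the minimum cost, with $\mathrm{opt}_{\mathcal Q}(\mathcal A)=\infty$ if there is no feasible solution. The problem $\mathcal Q$ is in the class $\mathrm{MIN\,F}^+\Pi_1$ if there are $c_S,c_x\in\mathbb N$ and a quantifier-free formula $\psi(\mathbf x,S)$ in conjunctive normal form over the vocabulary $\{R_1,\dots,R_t,S\}$ (without equality) in the variables $\mathbf x=(x_1,\dots,x_{c_x})$, where $S$ is a single $c_S$-ary relation symbol that does not occur negated in $\psi$, such that for every finite structure $\mathcal A$ of type $r$ $$\mathrm{opt}_{\mathcal Q}(\mathcal A)=\min_{S\subseteq A^{c_S}}\{|S| : (\mathcal A,S)\models \forall \mathbf x\in A^{c_x}:\ \psi(\mathbf x,S)\}.$$ Instances $(\mathcal A,k)$, $k\in\mathbb N$, are encoded as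 binary strings, where $A=\{0,\dots,n-1\}$, the number $n$ is written in unary, each $R_i$ is given by its characteristic table of $n^{r_i}$ bits, and $k$ is written in binary. The standard parameterization of $\mathcal Q$ is $p\text{-}\mathcal Q=(d\text{-}\mathcal Q,\kappa)$, where $d\text{-}\mathcal Q\subseteq\{0,1\}^*$ is the set of codes of all pairs $(\mathcal A,k)$ with $\mathrm{opt}_{\mathcal Q}(\mathcal A)\le k$, and $\kappa:\{0,1\}^*\to\mathbb N$ maps the code of $(\mathcal A,k)$ to $k$ and every string that is not a code to $0$. A polynomial-time computable function $K:\{0,1\}^*\to\{0,1\}^*$ is a kernelization of $p\text{-}\mathcal Q$ of size $h:\mathbb N\to\mathbb N$ if for all $w\in\{0,1\}^*$ $$\bigl(w\in d\text{-}\mathcal Q\iff K(w)\in d\text{-}\mathcal Q\bigr)\quad\text{and}\quad |K(w)|\le h(\kappa(w)).$$ **Theorem.** Let $\mathcal Q\in \mathrm{MIN\,F}^+\Pi_1$. Then $\kappa$ is computable in polynomial time, so that $p\text{-}\mathcal Q$ is a parameterized problem, and $p\text{-}\mathcal Q$ admits a polynomial kernelization, i.e. it has a kernelization whose size $h$ is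 a polynomial. More precisely, for every formula $\psi$ that expresses $\mathrm{opt}_{\mathcal Q}$ as above, if $s$ is the maximum number of occurrences of $S$ in a clause of $\psi$ and $m=\max(1,r_1,\dots,r_t)$, then there are a constant $c$ and a kernelization of $p\text{-}\mathcal Q$ of size $h(k)=c\,(k+1)^{sm}$. -/

import Mathlib

/-! ## Finite structures -/

/-- A finite structure of type `(r₁, …, r_t)`: a finite universe, normalised to `{0, …, size - 1}`,
together with an `rᵢ`-ary relation on it for every `i`. -/
structure FinStruct {t : ℕ} (r : Fin t → ℕ) where
  size : ℕ
  rel : ∀ i : Fin t, Finset (Fin (r i) → Fin size)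

/-! ## Formulas in conjunctive normal form over the vocabulary `{R₁, …, R_t, S}` -/

/-- Atomic formulas over `{R₁, …, R_t, S}` in the variables `x₀, …, x_{cx - 1}`,
where `Rᵢ` has arity `r i` and `S` has arity `cS`. -/
inductive SAtom {t : ℕ} (r : Fin t → ℕ) (cS cx : ℕ) where
  /-- the atom `Rᵢ(z)` -/
  | rel (i : Fin t) (z : Fin (r i) → Fin cx) : SAtom r cS cx
  /-- the atom `S(z)` -/
  | sol (z : Fin cS → Fin cx) : SAtom r cS cx

/-- A literal: an atom (`negated = false`) or the negation of an atom (`negated = true`). -/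
structure SLiteral {t : ℕ} (r : Fin t → ℕ) (cS cx : ℕ) where
  negated : Bool
  atom : SAtom r cS cx

/-- A quantifier-free formula in conjunctive normal form: a finite conjunction of clauses, each of
which is a finite disjunction of literals. -/
abbrev SCNF {t : ℕ} (r : Fin t → ℕ) (cS cx : ℕ) := List (List (SLiteral r cS cx))

namespace SAtom

variable {t : ℕ} {r : Fin t → ℕ} {cS cx : ℕ}

/-- Truth of an atom in `(A, S)` under the assignment `x` of the variables. -/
def Holds (A : FinStruct r) (S : Finset (Fin cS → Fin A.size)) (x : Fin cx → Fin A.size) :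
    SAtom r cS cx → Prop
  | .rel i z => (fun j => x (z j)) ∈ A.rel i
  | .sol z => (fun j => x (z j)) ∈ S

/-- Whether the relation symbol of an atom is `S`. -/
def isSol : SAtom r cS cx → Bool
  | .rel _ _ => false
  | .sol _ => true

end SAtom

/-- Truth of a literal in `(A, S)` under the assignment `x`. -/
def SLiteral.Holds {t : ℕ} {r : Fin t → ℕ} {cS cx : ℕ} (A : FinStruct r)
    (S : Finset (Fin cS → Fin A.size)) (x : Fin cx → Fin A.size) (l : SLiteral r cS cx) : Prop :=
  if l.negated then ¬ l.atom.Holds A S x else l.atom.Holds A S x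

namespace SCNF

variable {t : ℕ} {r : Fin t → ℕ} {cS cx : ℕ}

/-- Truth of a formula in conjunctive normal form in `(A, S)` under the assignment `x`. -/
def Holds (ψ : SCNF r cS cx) (A : FinStruct r) (S : Finset (Fin cS → Fin A.size))
    (x : Fin cx → Fin A.size) : Prop :=
  ∀ c ∈ ψ, ∃ l ∈ c, SLiteral.Holds A S x l

/-- `(A, S) ⊨ ∀ x, ψ(x, S)`. -/
def Models (ψ : SCNF r cS cx) (A : FinStruct r) (S : Finset (Fin cS → Fin A.size)) : Prop :=
  ∀ x : Fin cx → Fin A.size, ψ.Holds A S x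

/-- `ψ` is positive in `S`: the symbol `S` does not occur negated in `ψ`. -/
def PositiveInS (ψ : SCNF r cS cx) : Prop :=
  ∀ c ∈ ψ, ∀ l ∈ c, l.atom.isSol = true → l.negated = false

/-- `min_S { |S| : (A, S) ⊨ ∀ x, ψ(x, S) }`, with the value `⊤` if there is no such `S`. -/
noncomputable def minWeight (ψ : SCNF r cS cx) (A : FinStruct r) : ℕ∞ :=
  ⨅ S : {S : Finset (Fin cS → Fin A.size) // ψ.Models A S}, (S.1.card : ℕ∞)

/-- The maximum number of occurrences of `S` in a clause of `ψ`. -/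
def maxOccurrences (ψ : SCNF r cS cx) : ℕ :=
  (ψ.map fun c => c.countP fun l => l.atom.isSol).foldr max 0

end SCNF

/-! ## Minimization problems and the class MIN F⁺Π₁ -/

/-- A minimization problem on finite structures of type `r`: every instance has a set of feasible
solutions, each with a cost. -/
structure MinimizationProblem {t : ℕ} (r : Fin t → ℕ) where
  Solution : FinStruct r → Type
  cost : ∀ A : FinStruct r, Solution A → ℕ

/-- The optimum of an instance; it is `⊤` if the instance has no feasible solution. -/
noncomputable def MinimizationProblem.opt {t : ℕ} {r : Fin t → ℕ} (Q : MinimizationProblem r)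
    (A : FinStruct r) : ℕ∞ :=
  ⨅ s : Q.Solution A, (Q.cost A s : ℕ∞)

/-- `ψ` is positive in `S` and expresses the optimum of `Q` on all finite structures. -/
def SCNF.Expresses {t : ℕ} {r : Fin t → ℕ} {cS cx : ℕ} (ψ : SCNF r cS cx)
    (Q : MinimizationProblem r) : Prop :=
  ψ.PositiveInS ∧ ∀ A : FinStruct r, Q.opt A = ψ.minWeight A

/-- The class MIN F⁺Π₁ (on structures of type `r`). -/
def MinFPlusPi1 {t : ℕ} (r : Fin t → ℕ) : Set (MinimizationProblem r) :=
  {Q | ∃ (cS cx : ℕ) (ψ : SCNF r cS cx), ψ.Expresses Q}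

/-! ## Parameterized problems and kernelizations -/

/-- The data of a parameterized problem over the alphabet `α`: a language and a parameter. -/
structure ParameterizedProblem (α : Type) where
  lang : Set (List α)
  param : List α → ℕ

namespace ParameterizedProblem

variable {α : Type}

/-- The parameter is a parameterization: it is computable in polynomial time by a (multi-stack)
Turing machine, natural numbers being written in binary. -/
def HasPolyTimeParameter (P : ParameterizedProblem α) : Prop :=
  Nonempty (Turing.TM2ComputableInPolyTime (id : List α → List α) Nat.bits P.param)

/-- `K` is a kernelization of `P` with kernel size `h`: it is computable in polynomial time by a
(multi-stack) Turing machine, preserves membership, and has output length at most `h (κ x)`. -/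
def IsKernelization (P : ParameterizedProblem α) (K : List α → List α) (h : ℕ → ℕ) : Prop :=
  Nonempty (Turing.TM2ComputableInPolyTime (id : List α → List α) (id : List α → List α) K) ∧
    ∀ x : List α, (x ∈ P.lang ↔ K x ∈ P.lang) ∧ (K x).length ≤ h (P.param x)

/-- `P` admits a polynomial kernelization. -/
def AdmitsPolynomialKernelization (P : ParameterizedProblem α) : Prop :=
  ∃ (K : List α → List α) (h : Polynomial ℕ), P.IsKernelization K fun k => h.eval k

end ParameterizedProblem

/-! ## Encoding of instances as binary strings -/

namespace FinStruct

variable {t : ℕ} {r : Fin t → ℕ}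

/-- The characteristic table of the relation `Rᵢ`, a bit string of length `size ^ rᵢ`; the tuple
`z` is listed at position `∑ j, z j * size ^ j`. -/
def table (A : FinStruct r) (i : Fin t) : List Bool :=
  List.ofFn fun p : Fin (A.size ^ r i) => decide (finFunctionFinEquiv.symm p ∈ A.rel i)

/-- The string `0ⁿ 1 T₁ … T_t b` that encodes the instance `(A, k)`, where `n` is the size of the
universe of `A`, `Tᵢ` is the table of `Rᵢ`, and `b` is `k` in binary (least significant bit first,
without leading zeros). -/
def encode (A : FinStruct r) (k : ℕ) : List Bool :=
  List.replicate A.size false ++ true :: ((List.finRange t).flatMap A.table ++ k.bits)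

theorem length_table (A : FinStruct r) (i : Fin t) : (A.table i).length = A.size ^ r i := by
  simp [table]

theorem replicate_false_inj {m n : ℕ} {u v : List Bool}
    (h : List.replicate m false ++ true :: u = List.replicate n false ++ true :: v) :
    m = n ∧ u = v := by
  induction m generalizing n with
  | zero => cases n with
    | zero => simpa using h
    | succ n => simp [List.replicate_succ] at h
  | succ m ih => cases n with
    | zero => simp [List.replicate_succ] at h
    | succ n =>
      simp only [List.replicate_succ, List.cons_append, List.cons.injEq, true_and] at h
      obtain ⟨h1, h2⟩ := ih h
      exact ⟨by rw [h1], h2⟩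

theorem flatMap_append_inj {ι : Type} {f g : ι → List Bool}
    (hl : ∀ i, (f i).length = (g i).length) {l : List ι} {u v : List Bool}
    (h : l.flatMap f ++ u = l.flatMap g ++ v) : (∀ i ∈ l, f i = g i) ∧ u = v := by
  induction l with
  | nil => simpa using h
  | cons a l ih =>
    simp only [List.flatMap_cons, List.append_assoc] at h
    obtain ⟨h1, h2⟩ := List.append_inj h (hl a)
    obtain ⟨h3, h4⟩ := ih h2
    refine ⟨fun i hi => ?_, h4⟩
    rcases List.mem_cons.1 hi with rfl | hi
    · exact h1
    · exact h3 i hi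

/-- Distinct instances have distinct codes. -/
theorem encode_inj {A B : FinStruct r} {k l : ℕ} (h : A.encode k = B.encode l) :
    A = B ∧ k = l := by
  obtain ⟨n, R⟩ := A
  obtain ⟨m, R'⟩ := B
  obtain ⟨h1, h2⟩ := replicate_false_inj h
  simp only at h1
  subst h1
  obtain ⟨h3, h4⟩ := flatMap_append_inj (fun i => by simp [length_table]) h2
  refine ⟨?_, ?_⟩
  · congr 1
    funext i
    ext z
    have h5 := congrFun (List.ofFn_injective (h3 i (List.mem_finRange i)))
      (finFunctionFinEquiv z)
    simpa using h5
  · have hk : ∀ a b : ℕ, a.bits = b.bits → a = b := by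
      intro a b hab
      apply Nat.digits.injective 2
      rw [Nat.digits_two_eq_bits, Nat.digits_two_eq_bits, hab]
    exact hk _ _ h4

end FinStruct

/-! ## The standard parameterization -/

open Classical in
/-- The standard parameterization `p-Q`: the language of all (codes of) pairs `(A, k)` with
`opt_Q(A) ≤ k`, with the parameter `(A, k) ↦ k`. The parameter of a string that encodes no
instance is `0`. -/
noncomputable def MinimizationProblem.standardParameterization {t : ℕ} {r : Fin t → ℕ}
    (Q : MinimizationProblem r) : ParameterizedProblem Bool where
  lang := {w | ∃ (A : FinStruct r) (k : ℕ), w = A.encode k ∧ Q.opt A ≤ (k : ℕ∞)}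
  param w :=
    if h : ∃ I : FinStruct r × ℕ, w = I.1.encode I.2 then h.choose.2 else 0

theorem MinimizationProblem.param_encode {t : ℕ} {r : Fin t → ℕ} (Q : MinimizationProblem r)
    (A : FinStruct r) (k : ℕ) : Q.standardParameterization.param (A.encode k) = k := by
  have h : ∃ I : FinStruct r × ℕ, A.encode k = I.1.encode I.2 := ⟨(A, k), rfl⟩
  simp only [MinimizationProblem.standardParameterization]
  rw [dif_pos h]
  exact (FinStruct.encode_inj h.choose_spec).2.symm

theorem MinimizationProblem.encode_mem_lang {t : ℕ} {r : Fin t → ℕ} (Q : MinimizationProblem r)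
    (A : FinStruct r) (k : ℕ) :
    A.encode k ∈ Q.standardParameterization.lang ↔ Q.opt A ≤ (k : ℕ∞) := by
  constructor
  · rintro ⟨B, l, h, hB⟩
    obtain ⟨rfl, rfl⟩ := FinStruct.encode_inj h
    exact hB
  · exact fun h => ⟨A, k, rfl, h⟩

/-!
For a formula `ψ` that is positive in `S`, an instance `(A, k)` is a hitting set problem. Under an
assignment `x` of the variables, a clause is either satisfied by a literal without `S`, or it asks
that `S` contain one of at most `s` tuples, where `s` is the maximum number of occurrences of `S`
in a clause. The kernel is an induced substructure of `A` that contains sufficiently many of these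
constraints.

*Selection of constraints* (`Thinning`). For each clause, with `m` occurrences of `S`, the
assignments are scanned, and an assignment is chosen if, for every set `P` of positions, fewer than
`capacity k (m - |P|)` assignments chosen before agree with it on the tuples at the positions in
`P`. Here `capacity k 0 = 1` and `capacity k (i + 1) = (i + 1) * k * capacity k i + 1`. So the
chosen family never contains more than `capacity k (m - |P|)` constraints that share a part `P`
(`sparse_thin`), whence it has size `O((k + 1) ^ m)`. If `x` is not chosen, then some part `P` of it
is shared by `capacity k (m - |P|)` chosen constraints. A set of size at most `k` that avoids this
part hits at most `(m - |P|) * k * capacity k (m - |P| - 1)` of them, so a set of size at most `k`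
that hits all chosen constraints hits `x` as well (`hits_of_hits_thin`).

*Equivalence.* Let `A'` be the substructure induced on the elements that occur in chosen
assignments. Its constraints lie between the chosen ones and those of `A`. Hence `A` has a solution
of size at most `k` if and only if `A'` has one (`minWeight_pullback_le_iff`,
`models_of_holds_kept`). The universe of `A'` has size `O((k + 1) ^ s)`, which gives the bound on
the length of its code (`exists_length_kernel_le`).

*Running time.* Polynomial-time computability is established with a function algebra. The values
are binary trees, and the class `PolyFn` consists of the functions that are computed, within a
polynomial number of steps, by structured programs which replace the topmost tree on a stack; it is
closed under composition, pairing, case distinction, and iteration with polynomially bounded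
intermediate values (`PolyFn.iterate`, `PolyFn.foldl`). Programs are compiled to Turing machines
with the same bound on the number of steps (`Exec.reachesIn`), so that `PolyFn` functions on strings are
computable in polynomial time (`PolyFn.computableInPolyTime`). The kernelization is composed of such
functions. Numbers are written in unary there, which is harmless because the parameter may be cut
off at the number of all tuples that `S` can contain (`cappedValue`).
-/

/-! ### Stack programs and their compilation to Turing machines -/

namespace StackMachine

open Turing Function

/-- The four stacks of the machine model: `data` holds the values, the others are scratch space
which is empty between two operations. -/
inductive Stk
  | data | aux | spare | depth
  deriving DecidableEq

instance : Fintype Stk where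
  elems := {.data, .aux, .spare, .depth}
  complete := by rintro (_ | _ | _ | _) <;> decide

/-- The contents of the stacks, the top of a stack being the head of the list. -/
abbrev Store := Stk → List Bool

/-- Structured programs acting on the four stacks. The tests of `ite` and `loop` see the top of
one stack, which is `none` if that stack is empty. -/
inductive Prog
  | skip
  | push (k : Stk) (b : Bool)
  | pop (k : Stk)
  | seq (p q : Prog)
  | ite (k : Stk) (f : Option Bool → Bool) (p q : Prog)
  | loop (k : Stk) (f : Option Bool → Bool) (p : Prog)

/-- `Exec p s s' n`: the program `p`, started on the store `s`, terminates with the store `s'`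
after at most `n` elementary steps. -/
inductive Exec : Prog → Store → Store → ℕ → Prop
  | skip {s} : Exec .skip s s 1
  | push {s} (k b) : Exec (.push k b) s (update s k (b :: s k)) 1
  | pop {s} (k) : Exec (.pop k) s (update s k (s k).tail) 1
  | seq {p q s s' s'' m n} : Exec p s s' m → Exec q s' s'' n → Exec (.seq p q) s s'' (m + n)
  | ite_true {k f p q s s' n} : f (s k).head? = true → Exec p s s' n →
      Exec (.ite k f p q) s s' (n + 1)
  | ite_false {k f p q s s' n} : f (s k).head? = false → Exec q s s' n →
      Exec (.ite k f p q) s s' (n + 1)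
  | loop_done {k f p s} : f (s k).head? = false → Exec (.loop k f p) s s 1
  | loop_step {k f p s s' s'' m n} : f (s k).head? = true → Exec p s s' m →
      Exec (.loop k f p) s' s'' n → Exec (.loop k f p) s s'' (m + n + 1)
  | weaken {p s s' m n} : Exec p s s' m → m ≤ n → Exec p s s' n

namespace Prog

/-- The labels of the Turing machine code of a program. -/
def Lab : Prog → Type
  | .skip => Unit
  | .push _ _ => Unit
  | .pop _ => Unit
  | .seq p q => p.Lab ⊕ q.Lab
  | .ite _ _ p q => Option (p.Lab ⊕ q.Lab)
  | .loop _ _ p => Option p.Lab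

/-- The label at which the code of a program starts. -/
def entry : (p : Prog) → p.Lab
  | .skip => ()
  | .push _ _ => ()
  | .pop _ => ()
  | .seq p _ => Sum.inl p.entry
  | .ite _ _ _ _ => (none : Option _)
  | .loop _ _ _ => (none : Option _)

/-- There are only finitely many labels. -/
@[reducible] def labFintype : (p : Prog) → Fintype p.Lab
  | .skip => inferInstanceAs (Fintype Unit)
  | .push _ _ => inferInstanceAs (Fintype Unit)
  | .pop _ => inferInstanceAs (Fintype Unit)
  | .seq p q =>
    letI := p.labFintype
    letI := q.labFintype
    inferInstanceAs (Fintype (p.Lab ⊕ q.Lab))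
  | .ite _ _ p q =>
    letI := p.labFintype
    letI := q.labFintype
    inferInstanceAs (Fintype (Option (p.Lab ⊕ q.Lab)))
  | .loop _ _ p =>
    letI := p.labFintype
    inferInstanceAs (Fintype (Option p.Lab))

/-- The Turing machine code of a program, with its labels embedded by `e` in the label type `Λ`
and with `x` as the label to which control is passed at the end. The internal state of the machine
only serves to remember the symbol that a test has read. -/
def code {Λ : Type} : (p : Prog) → (p.Lab → Λ) → Λ → p.Lab →
    TM2.Stmt (fun _ : Stk => Bool) Λ (Option Bool)
  | .skip, _, x => fun _ => .goto fun _ => x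
  | .push k b, _, x => fun _ => .push k (fun _ => b) (.goto fun _ => x)
  | .pop k, _, x => fun _ => .pop k (fun v _ => v) (.goto fun _ => x)
  | .seq p q, e, x => fun l => match (l : p.Lab ⊕ q.Lab) with
    | .inl l => code p (fun l => e (Sum.inl l)) (e (Sum.inr q.entry)) l
    | .inr l => code q (fun l => e (Sum.inr l)) x l
  | .ite k f p q, e, x => fun l => match (l : Option (p.Lab ⊕ q.Lab)) with
    | none => .peek k (fun _ o => o) (.goto fun v =>
        if f v then e (some (Sum.inl p.entry) : Option (p.Lab ⊕ q.Lab))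
        else e (some (Sum.inr q.entry) : Option (p.Lab ⊕ q.Lab)))
    | some (.inl l) => code p (fun l => e (some (Sum.inl l) : Option (p.Lab ⊕ q.Lab))) x l
    | some (.inr l) => code q (fun l => e (some (Sum.inr l) : Option (p.Lab ⊕ q.Lab))) x l
  | .loop k f p, e, x => fun l => match (l : Option p.Lab) with
    | none => .peek k (fun _ o => o) (.goto fun v =>
        if f v then e (some p.entry : Option p.Lab) else x)
    | some l => code p (fun l => e (some l : Option p.Lab)) (e (none : Option p.Lab)) l

end Prog

section Compile

variable {Λ : Type} (M : Λ → TM2.Stmt (fun _ : Stk => Bool) Λ (Option Bool))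

/-- The machine `M` gets from the configuration `c` to `c'` in at most `n` steps. -/
def ReachesIn (c c' : TM2.Cfg (fun _ : Stk => Bool) Λ (Option Bool)) (n : ℕ) : Prop :=
  ∃ m ≤ n, (flip bind (TM2.step M))^[m] (some c) = some c'

variable {M}

theorem ReachesIn.trans {c₁ c₂ c₃ m n} (h₁ : ReachesIn M c₁ c₂ m) (h₂ : ReachesIn M c₂ c₃ n) :
    ReachesIn M c₁ c₃ (m + n) := by
  obtain ⟨a, ha, h₁⟩ := h₁
  obtain ⟨b, hb, h₂⟩ := h₂
  exact ⟨b + a, by omega, by rw [iterate_add_apply, h₁, h₂]⟩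

theorem ReachesIn.step {c c'} (h : TM2.step M c = some c') : ReachesIn M c c' 1 := ⟨1, le_rfl, h⟩

theorem ReachesIn.weaken {c c' m n} (h : ReachesIn M c c' m) (hn : m ≤ n) : ReachesIn M c c' n := by
  obtain ⟨a, ha, h⟩ := h
  exact ⟨a, ha.trans hn, h⟩

/-- The code of a program simulates its execution, every elementary step being one step of the
machine. -/
theorem Exec.reachesIn {p : Prog} {s s' : Store} {n : ℕ} (h : Exec p s s' n) :
    ∀ (e : p.Lab → Λ) (x : Λ) (_ : ∀ l, M (e l) = p.code e x l) (v : Option Bool),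
      ∃ v', ReachesIn M ⟨some (e p.entry), v, s⟩ ⟨some x, v', s'⟩ n := by
  induction h with
  | skip =>
    intro e x hM v
    exact ⟨v, .step (by simp [TM2.step, hM, Prog.code])⟩
  | push k b =>
    intro e x hM v
    exact ⟨v, .step (by simp [TM2.step, hM, Prog.code])⟩
  | pop k =>
    intro e x hM v
    exact ⟨v, .step (by simp [TM2.step, hM, Prog.code])⟩
  | @seq p q s s' s'' m n _ _ ih₁ ih₂ =>
    intro e x hM v
    obtain ⟨v₁, h₁⟩ := ih₁ (fun l => e (Sum.inl l)) (e (Sum.inr q.entry)) (fun l => hM _) v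
    obtain ⟨v₂, h₂⟩ := ih₂ (fun l => e (Sum.inr l)) x (fun l => hM _) v₁
    exact ⟨v₂, h₁.trans h₂⟩
  | @ite_true k f p q s s' n hf _ ih =>
    intro e x hM v
    obtain ⟨v₁, h₁⟩ := ih (fun l => e (some (Sum.inl l) : Option (p.Lab ⊕ q.Lab))) x
      (fun l => hM _) (s k).head?
    have hn := hM (none : Option (p.Lab ⊕ q.Lab))
    refine ⟨v₁, add_comm 1 n ▸ .trans (.step ?_) h₁⟩
    simp only [TM2.step, Prog.entry]
    rw [hn]
    simp [Prog.code, hf]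
  | @ite_false k f p q s s' n hf _ ih =>
    intro e x hM v
    obtain ⟨v₁, h₁⟩ := ih (fun l => e (some (Sum.inr l) : Option (p.Lab ⊕ q.Lab))) x
      (fun l => hM _) (s k).head?
    have hn := hM (none : Option (p.Lab ⊕ q.Lab))
    refine ⟨v₁, add_comm 1 n ▸ .trans (.step ?_) h₁⟩
    simp only [TM2.step, Prog.entry]
    rw [hn]
    simp [Prog.code, hf]
  | @loop_done k f p s hf =>
    intro e x hM v
    have hn := hM (none : Option p.Lab)
    refine ⟨(s k).head?, .step ?_⟩
    simp only [TM2.step, Prog.entry]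
    rw [hn]
    simp [Prog.code, hf]
  | @loop_step k f p s s' s'' m n hf _ _ ih₁ ih₂ =>
    intro e x hM v
    obtain ⟨v₁, h₁⟩ := ih₁ (fun l => e (some l : Option p.Lab)) (e (none : Option p.Lab))
      (fun l => hM _) (s k).head?
    obtain ⟨v₂, h₂⟩ := ih₂ e x hM v₁
    have hn := hM (none : Option p.Lab)
    refine ⟨v₂, (ReachesIn.trans (.step ?_) (h₁.trans h₂)).weaken (by omega)⟩
    simp only [TM2.step, Prog.entry]
    rw [hn]
    simp [Prog.code, hf]
  | weaken _ hle ih =>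
    intro e x hM v
    obtain ⟨v', h⟩ := ih e x hM v
    exact ⟨v', h.weaken hle⟩

end Compile

/-- The Turing machine that runs the program `p`, with `aux` as input and output stack. The
additional label `none` resets the internal state, as is required at the end, and halts. -/
def Prog.machine (p : Prog) : FinTM2 :=
  letI := p.labFintype
  { K := Stk
    k₀ := .aux
    k₁ := .aux
    Γ := fun _ => Bool
    Λ := Option p.Lab
    main := some p.entry
    σ := Option Bool
    initialState := none
    Γk₀Fin := inferInstanceAs (Fintype Bool)
    m := fun l => match l with
      | none => .load (fun _ => none) .halt
      | some l => p.code some none l }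

/-- The store with the given contents of the four stacks. -/
def mk (d a b c : List Bool) : Store
  | .data => d
  | .aux => a
  | .spare => b
  | .depth => c

section mk

variable (d a b c l : List Bool)

@[simp] theorem mk_data : mk d a b c .data = d := rfl
@[simp] theorem mk_aux : mk d a b c .aux = a := rfl
@[simp] theorem mk_spare : mk d a b c .spare = b := rfl
@[simp] theorem mk_depth : mk d a b c .depth = c := rfl

@[simp] theorem update_mk_data : update (mk d a b c) .data l = mk l a b c := by
  funext k; cases k <;> rfl
@[simp] theorem update_mk_aux : update (mk d a b c) .aux l = mk d l b c := by
  funext k; cases k <;> rfl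
@[simp] theorem update_mk_spare : update (mk d a b c) .spare l = mk d a l c := by
  funext k; cases k <;> rfl
@[simp] theorem update_mk_depth : update (mk d a b c) .depth l = mk d a b l := by
  funext k; cases k <;> rfl

end mk

/-- A program that computes `f` from `aux` to `aux` in time `q` shows that `f` is polynomial-time
computable; `g` is the same function with its values not yet encoded as strings. -/
theorem computableInPolyTime_of_exec {β : Type} (p : Prog) (q : Polynomial ℕ)
    (eb : β → List Bool) (g : List Bool → β)
    (h : ∀ w, Exec p (mk [] w [] []) (mk [] (eb (g w)) [] []) (q.eval w.length)) :
    Nonempty (TM2ComputableInPolyTime (id : List Bool → List Bool) eb g) := by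
  have key : ∀ w : List Bool, ∃ m ≤ q.eval w.length + 1,
      (flip bind p.machine.step)^[m] (some (initList p.machine w)) =
        some (haltList p.machine (eb (g w))) := by
    intro w
    obtain ⟨v', h₁⟩ := (h w).reachesIn (M := p.machine.m) some none (fun l => rfl) none
    have h₂ : ReachesIn p.machine.m ⟨some none, v', mk [] (eb (g w)) [] []⟩
        ⟨none, none, mk [] (eb (g w)) [] []⟩ 1 := .step rfl
    obtain ⟨m, hm, h₃⟩ := h₁.trans h₂
    refine ⟨m, hm, ?_⟩
    have e₁ : initList p.machine w = ⟨some (some p.entry), none, mk [] w [] []⟩ := by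
      unfold initList
      congr 1
      funext k
      cases k <;> rfl
    have e₂ : haltList p.machine (eb (g w)) = ⟨none, none, mk [] (eb (g w)) [] []⟩ := by
      unfold haltList
      congr 1
      funext k
      cases k <;> rfl
    rw [e₁, e₂]
    exact h₃
  choose m hm hrun using key
  refine ⟨{ tm := p.machine, inputAlphabet := Equiv.refl Bool, outputAlphabet := Equiv.refl Bool,
            time := q + 1, outputsFun := fun w => ⟨⟨m w, ?_⟩, ?_⟩ }⟩
  · have e₁ : initList p.machine (List.map id w) = initList p.machine w :=
      congrArg (initList p.machine) (List.map_id w)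
    have e₂ : haltList p.machine (List.map id (eb (g w))) = haltList p.machine (eb (g w)) :=
      congrArg (haltList p.machine) (List.map_id (eb (g w)))
    exact (congrArg (fun c => (flip bind p.machine.step)^[m w] (some c)) e₁).trans
      ((hrun w).trans (congrArg some e₂.symm))
  · simpa using hm w

end StackMachine

namespace StackMachine

open Turing Function

/-! ### Binary trees on the stacks -/

/-- Binary trees, the universal data type of the programs. -/
inductive Data
  | leaf
  | node (l r : Data)

namespace Data

/-- The preorder code of a tree: `true` for an inner node, `false` for a leaf. -/
def code : Data → List Bool
  | leaf => [false]
  | node l r => true :: (l.code ++ r.code)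

/-- The length of the code of a tree. -/
def size (x : Data) : ℕ := x.code.length

/-- The length of the rightmost path of a tree, which is the length of the list that it encodes. -/
def spine : Data → ℕ
  | leaf => 0
  | node _ r => r.spine + 1

@[simp] theorem size_leaf : size leaf = 1 := rfl

@[simp] theorem size_node (l r : Data) : size (node l r) = l.size + r.size + 1 := by
  simp [size, code]

theorem spine_le_size (x : Data) : x.spine ≤ x.size := by
  induction x with
  | leaf => simp [spine]
  | node l r _ ih => simp only [spine, size_node]; omega

end Data

namespace Prog

/-- Move all symbols from the stack `k` to the stack `k'`. -/
def transfer (k k' : Stk) : Prog :=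
  .loop k Option.isSome (.ite k (· == some true)
    (.seq (.pop k) (.push k' true)) (.seq (.pop k) (.push k' false)))

/-- The body of `stash`. -/
def stashBody : Prog :=
  .ite .data (· == some true)
    (.seq (.pop .data) (.seq (.push .aux true) (.push .depth true)))
    (.seq (.pop .data) (.seq (.push .aux false) (.pop .depth)))

/-- Move the topmost tree from `data` to `aux`, which reverses its code. The height of `depth` is
the number of subtrees still to be read. -/
def stash : Prog := .seq (.push .depth true) (.loop .depth Option.isSome stashBody)

/-- Empty the stack `aux`. -/
def clear : Prog := .loop .aux Option.isSome (.pop .aux)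

/-- Delete the topmost tree. -/
def drop : Prog := .seq stash clear

/-- Move the contents of `aux` to both `data` and `spare`. -/
def copyBack : Prog :=
  .loop .aux Option.isSome (.ite .aux (· == some true)
    (.seq (.pop .aux) (.seq (.push .data true) (.push .spare true)))
    (.seq (.pop .aux) (.seq (.push .data false) (.push .spare false))))

/-- Duplicate the topmost tree. -/
def dup : Prog := .seq stash (.seq copyBack (.seq (transfer .spare .aux) (transfer .aux .data)))

/-- Exchange the two topmost trees. -/
def swap : Prog :=
  .seq stash (.seq (transfer .aux .spare) (.seq stash (.seq (transfer .spare .depth)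
    (.seq (transfer .depth .data) (transfer .aux .data)))))

/-- Push the string `l` on `data`. -/
def write : List Bool → Prog
  | [] => .skip
  | b :: l => .seq (write l) (.push .data b)

end Prog

open Prog

theorem Exec.transfer {k k' : Stk} (hk : k ≠ k') (l : List Bool) : ∀ s : Store, s k = l →
    Exec (Prog.transfer k k') s (update (update s k []) k' (l.reverse ++ s k'))
      (4 * l.length + 1) := by
  induction l with
  | nil =>
    intro s hs
    have : update (update s k []) k' (([] : List Bool).reverse ++ s k') = s := by
      funext j
      by_cases h1 : j = k'
      · subst h1; simp
      · by_cases h2 : j = k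
        · subst h2; simp [h1, hs]
        · simp [h1, h2]
    rw [this]
    exact .loop_done (by simp [hs])
  | cons b l ih =>
    intro s hs
    have h1 : Exec (.ite k (· == some true)
        (.seq (.pop k) (.push k' true)) (.seq (.pop k) (.push k' false))) s
        (update (update s k l) k' (b :: s k')) 3 := by
      have h2 : ∀ b, Exec (.seq (.pop k) (.push k' b)) s
          (update (update s k l) k' (b :: s k')) 2 := by
        intro b
        have h3 : Exec (.pop k) s (update s k l) 1 := by
          have := Exec.pop (s := s) k
          rwa [hs] at this
        have h4 := Exec.push (s := update s k l) k' b
        rw [update_of_ne hk.symm] at h4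
        exact h3.seq h4
      cases b
      · exact .ite_false (by simp [hs]) (h2 _)
      · exact .ite_true (by simp [hs]) (h2 _)
    have h2 := ih (update (update s k l) k' (b :: s k')) (by simp [update_of_ne hk])
    have h3 := Exec.loop_step (f := Option.isSome) (by simp [hs]) h1 h2
    have h4 : update (update (update (update s k l) k' (b :: s k')) k []) k'
        (l.reverse ++ (update (update s k l) k' (b :: s k')) k') =
        update (update s k []) k' ((b :: l).reverse ++ s k') := by
      funext j
      by_cases hj : j = k'
      · subst hj; simp
      · by_cases hj' : j = k
        · subst hj'; simp [hj]
        · simp [hj, hj']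
    rw [h4] at h3
    exact h3.weaken (by simp; omega)

section Operations

variable (x y : Data) (b : Bool) (l d a s c : List Bool)

theorem Exec.push_data : Exec (.push .data b) (mk d a s c) (mk (b :: d) a s c) 1 := by
  simpa using Exec.push (s := mk d a s c) .data b

theorem Exec.push_aux : Exec (.push .aux b) (mk d a s c) (mk d (b :: a) s c) 1 := by
  simpa using Exec.push (s := mk d a s c) .aux b

theorem Exec.push_spare : Exec (.push .spare b) (mk d a s c) (mk d a (b :: s) c) 1 := by
  simpa using Exec.push (s := mk d a s c) .spare b

theorem Exec.push_depth : Exec (.push .depth b) (mk d a s c) (mk d a s (b :: c)) 1 := by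
  simpa using Exec.push (s := mk d a s c) .depth b

theorem Exec.pop_data : Exec (.pop .data) (mk (b :: d) a s c) (mk d a s c) 1 := by
  simpa using Exec.pop (s := mk (b :: d) a s c) .data

theorem Exec.pop_aux : Exec (.pop .aux) (mk d (b :: a) s c) (mk d a s c) 1 := by
  simpa using Exec.pop (s := mk d (b :: a) s c) .aux

theorem Exec.pop_spare : Exec (.pop .spare) (mk d a (b :: s) c) (mk d a s c) 1 := by
  simpa using Exec.pop (s := mk d a (b :: s) c) .spare

theorem Exec.pop_depth : Exec (.pop .depth) (mk d a s (b :: c)) (mk d a s c) 1 := by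
  simpa using Exec.pop (s := mk d a s (b :: c)) .depth

/-- The loop of `stash` moves one tree and then continues with one pending subtree less. This form,
with the rest of the run as a hypothesis, allows an induction on the tree. -/
theorem Exec.stash_loop {n : ℕ} {s' : Store} : ∀ {d a c : List Bool},
    Exec (.loop .depth Option.isSome stashBody) (mk d (x.code.reverse ++ a) s c) s' n →
    Exec (.loop .depth Option.isSome stashBody) (mk (x.code ++ d) a s (true :: c)) s'
      (5 * x.size + n) := by
  induction x generalizing n with
  | leaf =>
    intro d a c h
    have h1 : Exec stashBody (mk (false :: d) a s (true :: c)) (mk d (false :: a) s c) 4 :=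
      .ite_false (by simp) (.seq (.pop_data ..) (.seq (.push_aux ..) (.pop_depth ..)))
    exact (Exec.loop_step (by simp) h1 h).weaken (by simp only [Data.size_leaf]; omega)
  | node l r ihl ihr =>
    intro d a c h
    have h1 : Exec stashBody (mk ((true :: (l.code ++ r.code)) ++ d) a s (true :: c))
        (mk (l.code ++ (r.code ++ d)) (true :: a) s (true :: true :: c)) 4 := by
      rw [← List.append_assoc]
      exact .ite_true (by simp) (.seq (.pop_data ..) (.seq (.push_aux ..) (.push_depth ..)))
    have h2 : Exec (.loop .depth Option.isSome stashBody)
        (mk (l.code ++ (r.code ++ d)) (true :: a) s (true :: true :: c)) s'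
        (5 * l.size + (5 * r.size + n)) := by
      refine ihl (ihr ?_)
      simpa [Data.code] using h
    exact (Exec.loop_step (by simp) h1 h2).weaken (by simp; omega)

theorem Exec.stash : Exec stash (mk (x.code ++ d) a s []) (mk d (x.code.reverse ++ a) s [])
    (5 * x.size + 2) :=
  (Exec.seq (.push_depth ..) (Exec.stash_loop x s (.loop_done (by simp)))).weaken
    (by omega)

theorem Exec.clear : Exec clear (mk d a s c) (mk d [] s c) (2 * a.length + 1) := by
  induction a with
  | nil => exact .loop_done (by simp)
  | cons b a ih =>
    exact (Exec.loop_step (by simp) (.pop_aux ..) ih).weaken (by simp; omega)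

theorem Exec.drop : Exec drop (mk (x.code ++ d) [] s []) (mk d [] s []) (7 * x.size + 3) :=
  (Exec.seq (.stash ..) (.clear ..)).weaken (by simp [Data.size]; omega)

theorem Exec.copyBack : Exec copyBack (mk d a s c) (mk (a.reverse ++ d) [] (a.reverse ++ s) c)
    (5 * a.length + 1) := by
  induction a generalizing d s with
  | nil => exact .loop_done (by simp)
  | cons b a ih =>
    have h1 : Exec (.ite .aux (· == some true)
        (.seq (.pop .aux) (.seq (.push .data true) (.push .spare true)))
        (.seq (.pop .aux) (.seq (.push .data false) (.push .spare false))))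
        (mk d (b :: a) s c) (mk (b :: d) a (b :: s) c) 4 := by
      cases b
      · exact .ite_false (by simp) (.seq (.pop_aux ..) (.seq (.push_data ..) (.push_spare ..)))
      · exact .ite_true (by simp) (.seq (.pop_aux ..) (.seq (.push_data ..) (.push_spare ..)))
    have h2 := Exec.loop_step (f := Option.isSome) (by simp) h1 (ih (b :: d) (b :: s))
    simp only [List.reverse_cons, List.append_assoc, List.singleton_append]
    exact h2.weaken (by simp; omega)

theorem Exec.aux_data : Exec (Prog.transfer .aux .data) (mk d a s c) (mk (a.reverse ++ d) [] s c)
    (4 * a.length + 1) := by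
  simpa using Exec.transfer (k := .aux) (k' := .data) (by decide) a (mk d a s c) rfl

theorem Exec.aux_spare : Exec (Prog.transfer .aux .spare) (mk d a s c) (mk d [] (a.reverse ++ s) c)
    (4 * a.length + 1) := by
  simpa using Exec.transfer (k := .aux) (k' := .spare) (by decide) a (mk d a s c) rfl

theorem Exec.spare_aux : Exec (Prog.transfer .spare .aux) (mk d a s c) (mk d (s.reverse ++ a) [] c)
    (4 * s.length + 1) := by
  simpa using Exec.transfer (k := .spare) (k' := .aux) (by decide) s (mk d a s c) rfl

theorem Exec.spare_depth : Exec (Prog.transfer .spare .depth) (mk d a s c) (mk d a [] (s.reverse ++ c))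
    (4 * s.length + 1) := by
  simpa using Exec.transfer (k := .spare) (k' := .depth) (by decide) s (mk d a s c) rfl

theorem Exec.depth_data : Exec (Prog.transfer .depth .data) (mk d a s c) (mk (c.reverse ++ d) a s [])
    (4 * c.length + 1) := by
  simpa using Exec.transfer (k := .depth) (k' := .data) (by decide) c (mk d a s c) rfl

theorem Exec.depth_aux : Exec (Prog.transfer .depth .aux) (mk d a s c) (mk d (c.reverse ++ a) s [])
    (4 * c.length + 1) := by
  simpa using Exec.transfer (k := .depth) (k' := .aux) (by decide) c (mk d a s c) rfl

theorem Exec.dup : Exec dup (mk (x.code ++ d) [] [] []) (mk (x.code ++ (x.code ++ d)) [] [] [])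
    (18 * x.size + 5) := by
  have h := Exec.seq (.stash x d [] []) (.seq (.copyBack ..) (.seq (.spare_aux ..) (.aux_data ..)))
  simp only [List.append_nil, List.reverse_reverse] at h
  exact h.weaken (by simp [Data.size]; omega)

theorem Exec.swap : Exec swap (mk (x.code ++ (y.code ++ d)) [] [] [])
    (mk (y.code ++ (x.code ++ d)) [] [] []) (17 * (x.size + y.size) + 8) := by
  have h := Exec.seq (.stash x (y.code ++ d) [] []) (.seq (.aux_spare ..) (.seq (.stash ..)
    (.seq (.spare_depth ..) (.seq (.depth_data ..) (.aux_data ..)))))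
  simp only [List.append_nil, List.reverse_reverse] at h
  exact h.weaken (by simp [Data.size]; omega)

theorem Exec.write : Exec (write l) (mk d a s c) (mk (l ++ d) a s c) (l.length + 1) := by
  induction l with
  | nil => exact .skip
  | cons b l ih => exact .seq ih (.push_data ..)

end Operations

end StackMachine

namespace StackMachine

open Turing Function

/-! ### Data types represented by trees -/

/-- Data types whose elements are represented by trees. -/
class Coded (α : Type) where
  data : α → Data

section Coded

variable {α β : Type} [Coded α] [Coded β]

instance : Coded Unit := ⟨fun _ => .leaf⟩

instance : Coded Bool := ⟨fun b => if b then .node .leaf .leaf else .leaf⟩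

instance : Coded (α × β) := ⟨fun p => .node (Coded.data p.1) (Coded.data p.2)⟩

instance : Coded (List α) := ⟨fun l => l.foldr (fun a x => .node (Coded.data a) x) .leaf⟩

/-- Natural numbers are represented in unary, like lists of units. -/
instance : Coded ℕ := ⟨fun n => Coded.data (List.replicate n ())⟩

/-- The code of an element, as a bit string. -/
def code (a : α) : List Bool := (Coded.data a).code

/-- The length of the code of an element. -/
def size (a : α) : ℕ := (Coded.data a).size

theorem one_le_size (a : α) : 1 ≤ size a := by
  unfold size
  cases Coded.data a <;> simp

@[simp] theorem size_unit (u : Unit) : size u = 1 := rfl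

@[simp] theorem size_pair (p : α × β) : size p = size p.1 + size p.2 + 1 := Data.size_node _ _

@[simp] theorem size_nil : size ([] : List α) = 1 := rfl

@[simp] theorem size_cons (a : α) (l : List α) : size (a :: l) = size a + size l + 1 :=
  Data.size_node _ _

theorem size_bool_le (b : Bool) : size b ≤ 3 := by
  cases b <;> decide

@[simp] theorem size_nat (n : ℕ) : size n = 2 * n + 1 := by
  have : size n = size (List.replicate n ()) := rfl
  rw [this]
  induction n with
  | zero => rfl
  | succ n ih => rw [List.replicate_succ, size_cons, ih rfl, size_unit]; omega

@[simp] theorem code_pair (p : α × β) : code p = true :: (code p.1 ++ code p.2) := rfl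

@[simp] theorem code_nil : code ([] : List α) = [false] := rfl

@[simp] theorem code_cons (a : α) (l : List α) : code (a :: l) = true :: (code a ++ code l) := rfl

@[simp] theorem code_false : code false = [false] := rfl

@[simp] theorem code_true : code true = [true, false, false] := rfl

theorem spine_list (l : List α) : (Coded.data l).spine = l.length := by
  induction l with
  | nil => rfl
  | cons a l ih => exact congrArg (· + 1) ih

theorem size_append (l l' : List α) : size (l ++ l') + 1 = size l + size l' := by
  induction l with
  | nil => simp; omega
  | cons a l ih => simp only [List.cons_append, size_cons]; omega

theorem size_mem_le {a : α} {l : List α} (h : a ∈ l) : size a ≤ size l := by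
  induction l with
  | nil => simp at h
  | cons b l ih =>
    rcases List.mem_cons.1 h with rfl | h
    · simp; omega
    · have := ih h; simp; omega

theorem length_le_size (l : List α) : l.length ≤ size l := by
  rw [← spine_list]
  exact Data.spine_le_size _

end Coded

/-! ### Polynomial bounds -/

theorem eval_mono (q : Polynomial ℕ) {m n : ℕ} (h : m ≤ n) : q.eval m ≤ q.eval n := by
  simp only [Polynomial.eval_eq_sum, Polynomial.sum]
  exact Finset.sum_le_sum fun i _ => Nat.mul_le_mul_left _ (Nat.pow_le_pow_left h i)

/-- The function `b` is bounded by a polynomial in the size of its argument. -/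
def PolyBdd {α : Type} [Coded α] (b : α → ℕ) : Prop :=
  ∃ q : Polynomial ℕ, ∀ a, b a ≤ q.eval (size a)

namespace PolyBdd

variable {α β : Type} [Coded α] [Coded β] {b c : α → ℕ}

theorem mono (hb : PolyBdd b) (h : ∀ a, c a ≤ b a) : PolyBdd c := by
  obtain ⟨q, hq⟩ := hb
  exact ⟨q, fun a => (h a).trans (hq a)⟩

theorem const (n : ℕ) : PolyBdd fun _ : α => n := ⟨Polynomial.C n, fun a => by simp⟩

theorem size : PolyBdd fun a : α => size a := ⟨Polynomial.X, fun a => by simp⟩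

theorem add (hb : PolyBdd b) (hc : PolyBdd c) : PolyBdd fun a => b a + c a := by
  obtain ⟨q, hq⟩ := hb
  obtain ⟨q', hq'⟩ := hc
  exact ⟨q + q', fun a => by simpa using Nat.add_le_add (hq a) (hq' a)⟩

theorem mul (hb : PolyBdd b) (hc : PolyBdd c) : PolyBdd fun a => b a * c a := by
  obtain ⟨q, hq⟩ := hb
  obtain ⟨q', hq'⟩ := hc
  exact ⟨q * q', fun a => by simpa using Nat.mul_le_mul (hq a) (hq' a)⟩

theorem comp {b : β → ℕ} {f : α → β} (hb : PolyBdd b)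
    (hf : PolyBdd fun a => StackMachine.size (f a)) : PolyBdd fun a => b (f a) := by
  obtain ⟨q, hq⟩ := hb
  obtain ⟨q', hq'⟩ := hf
  exact ⟨q.comp q', fun a => by
    simpa [Polynomial.eval_comp] using (hq (f a)).trans (eval_mono q (hq' a))⟩

end PolyBdd

/-! ### Polynomial-time functions -/

/-- The function `f` is computed in polynomial time by a stack program that replaces the topmost
tree on the stack `data`, which is the code of the argument, by the code of the value. -/
def PolyFn {α β : Type} [Coded α] [Coded β] (f : α → β) : Prop :=
  PolyBdd (fun a => size (f a)) ∧ ∃ (p : Prog) (b : α → ℕ), PolyBdd b ∧ ∀ a rest,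
    Exec p (mk (code a ++ rest) [] [] []) (mk (code (f a) ++ rest) [] [] []) (b a)

namespace PolyFn

variable {α β γ σ : Type} [Coded α] [Coded β] [Coded γ] [Coded σ]

theorem polyBdd {f : α → β} (h : PolyFn f) : PolyBdd fun a => size (f a) := h.1

/-- A function that does not change the code is computed by the empty program. -/
theorem of_code_eq {f : α → β} (h : ∀ a, Coded.data (f a) = Coded.data a) : PolyFn f := by
  refine ⟨PolyBdd.size.mono fun a => by rw [size, h, size], .skip, fun _ => 1, .const 1, ?_⟩
  intro a rest
  rw [code, code, h]
  exact .skip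

protected theorem id : PolyFn fun a : α => a := of_code_eq fun _ => rfl

theorem comp {g : β → γ} {f : α → β} (hg : PolyFn g) (hf : PolyFn f) :
    PolyFn fun a => g (f a) := by
  obtain ⟨hg1, pg, bg, hbg, hg⟩ := hg
  obtain ⟨hf1, pf, bf, hbf, hf⟩ := hf
  exact ⟨hg1.comp hf1, .seq pf pg, _, hbf.add (hbg.comp hf1),
    fun a rest => (hf a rest).seq (hg (f a) rest)⟩

theorem const (c : β) : PolyFn fun _ : α => c := by
  refine ⟨.const _, .seq .drop (.write (code c)), _,
    (((PolyBdd.const 7).mul .size).add (.const 3)).add (.const ((code c).length + 1)), ?_⟩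
  exact fun a rest => (Exec.drop (Coded.data a) rest []).seq (.write (code c) rest [] [] [])

theorem pair {f : α → β} {g : α → γ} (hf : PolyFn f) (hg : PolyFn g) :
    PolyFn fun a => (f a, g a) := by
  obtain ⟨hf1, pf, bf, hbf, hf⟩ := hf
  obtain ⟨hg1, pg, bg, hbg, hg⟩ := hg
  refine ⟨((hf1.add hg1).add (.const 1)).mono fun a => by simp,
    .seq .dup (.seq pg (.seq .swap (.seq pf (.push .data true)))),
    _, (((PolyBdd.const 18).mul .size).add (.const 5)).add (hbg.add
      ((((PolyBdd.const 17).mul (hg1.add .size)).add (.const 8)).add (hbf.add (.const 1)))), ?_⟩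
  intro a rest
  have h := Exec.seq (.dup (Coded.data a) rest) (.seq (hg a (code a ++ rest))
    (.seq (.swap (Coded.data (g a)) (Coded.data a) rest) (.seq (hf a (code (g a) ++ rest))
      (.push_data true ..))))
  rw [code_pair, List.cons_append, List.append_assoc]
  exact h

theorem fst : PolyFn fun p : α × β => p.1 := by
  refine ⟨PolyBdd.size.mono fun p => by change size p.1 ≤ size p; rw [size_pair]; omega,
    .seq (.pop .data) (.seq .swap .drop), _,
    (((PolyBdd.const 24).mul .size).add (.const 12) : PolyBdd _), ?_⟩
  intro p rest
  have h := Exec.seq (.pop_data true (code p.1 ++ (code p.2 ++ rest)) [] [] [])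
    (.seq (.swap (Coded.data p.1) (Coded.data p.2) rest) (.drop (Coded.data p.2) _ []))
  rw [code_pair, List.cons_append, List.append_assoc]
  refine h.weaken ?_
  have : size p = (Coded.data p.1).size + (Coded.data p.2).size + 1 := size_pair p
  rw [this]
  omega

theorem snd : PolyFn fun p : α × β => p.2 := by
  refine ⟨PolyBdd.size.mono fun p => by change size p.2 ≤ size p; rw [size_pair]; omega,
    .seq (.pop .data) .drop, _,
    (((PolyBdd.const 7).mul .size).add (.const 4) : PolyBdd _), ?_⟩
  intro p rest
  have h := Exec.seq (.pop_data true (code p.1 ++ (code p.2 ++ rest)) [] [] [])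
    (.drop (Coded.data p.1) _ [])
  rw [code_pair, List.cons_append, List.append_assoc]
  refine h.weaken ?_
  have : size p = (Coded.data p.1).size + (Coded.data p.2).size + 1 := size_pair p
  rw [this]
  omega

theorem fst' {f : α → β × γ} (hf : PolyFn f) : PolyFn fun a => (f a).1 := fst.comp hf

theorem snd' {f : α → β × γ} (hf : PolyFn f) : PolyFn fun a => (f a).2 := snd.comp hf

/-- Case distinction on a list. -/
theorem casesList {l : α → List β} {g : α → γ} {h : α → β → List β → γ} (hl : PolyFn l)
    (hg : PolyFn g) (hh : PolyFn fun p : α × (β × List β) => h p.1 p.2.1 p.2.2) :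
    PolyFn fun a => (match l a with
      | [] => g a
      | b :: t => h a b t : γ) := by
  obtain ⟨hl1, pl, bl, hbl, hl⟩ := hl
  obtain ⟨hg1, pg, bg, hbg, hg⟩ := hg
  obtain ⟨hh1, ph, ⟨bh, hbh⟩⟩ := hh
  obtain ⟨⟨qh, hqh⟩, hh⟩ := hbh
  obtain ⟨qs, hqs⟩ := hh1
  -- the second branch is applied to a tree of size `size (l a) + size a + 1`
  have hs := PolyBdd.add (hl1.add .size) (.const 1)
  have hS : ∀ q : Polynomial ℕ, PolyBdd fun a => q.eval (size (l a) + size a + 1) := by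
    intro q
    obtain ⟨q', hq'⟩ := hs
    exact ⟨q.comp q', fun a => by
      rw [Polynomial.eval_comp]
      exact eval_mono q (hq' a)⟩
  refine ⟨(hg1.add (hS qs)).mono fun a => ?_,
    .seq .dup (.seq pl (.ite .data (· == some true)
      (.seq .swap (.seq (.push .data true) ph)) (.seq (.pop .data) pg))), _,
    (((PolyBdd.const 18).mul .size).add (.const 5)).add (hbl.add
      ((((((PolyBdd.const 17).mul (hl1.add .size)).add (.const 8)).add (.const 2)).add
        (hS qh)).add (hbg.add (.const 2)))), ?_⟩
  · dsimp only
    rcases hla : l a with _ | ⟨b, t⟩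
    · exact Nat.le_add_right _ _
    · refine (hqs (a, (b, t))).trans ?_
      refine (eval_mono qs ?_).trans (Nat.le_add_left _ _)
      simp only [size_pair, size_cons]
      omega
  · intro a rest
    have h0 := hl a (code a ++ rest)
    dsimp only
    rcases hla : l a with _ | ⟨b, t⟩
    · rw [hla] at h0
      have h1 : Exec (.ite .data (· == some true) (.seq .swap (.seq (.push .data true) ph))
          (.seq (.pop .data) pg)) (mk (code ([] : List β) ++ (code a ++ rest)) [] [] [])
          (mk (code (g a) ++ rest) [] [] []) (1 + bg a + 1) :=
        .ite_false (by simp) (.seq (.pop_data ..) (hg a rest))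
      refine ((Exec.dup (Coded.data a) rest).seq (h0.seq h1)).weaken ?_
      change 18 * size a + 5 + _ ≤ _
      omega
    · rw [hla] at h0
      have h1 := hh (a, (b, t)) rest
      rw [code_pair, List.cons_append, List.append_assoc] at h1
      have h2 := Exec.swap (Coded.data (b :: t)) (Coded.data a) rest
      have h3 : Exec (.ite .data (· == some true) (.seq .swap (.seq (.push .data true) ph))
          (.seq (.pop .data) pg)) (mk (code (b :: t) ++ (code a ++ rest)) [] [] [])
          (mk (code (h a b t) ++ rest) [] [] []) _ :=
        .ite_true (by simp) (h2.seq (.seq (.push_data true ..) h1))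
      refine ((Exec.dup (Coded.data a) rest).seq (h0.seq h3)).weaken ?_
      have h4 : bh (a, (b, t)) ≤ qh.eval (size (b :: t) + size a + 1) := by
        refine (hqh _).trans (eval_mono qh ?_)
        simp only [size_pair, size_cons]
        omega
      change 18 * size a + 5 + (bl a + (17 * (size (b :: t) + size a) + 8 + _ + 1)) ≤ _
      omega

/-- Case distinction on a truth value. -/
theorem ite {c : α → Bool} {f g : α → β} (hc : PolyFn c) (hf : PolyFn f) (hg : PolyFn g) :
    PolyFn fun a => if c a then f a else g a := by
  obtain ⟨hc1, pc, bc, hbc, hc⟩ := hc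
  obtain ⟨hg1, pg, bg, hbg, hg⟩ := hg
  obtain ⟨hf1, pf, bf, hbf, hf⟩ := hf
  refine ⟨(hf1.add hg1).mono fun a => ?_,
    .seq .dup (.seq pc (.ite .data (· == some true)
      (.seq (.pop .data) (.seq (.pop .data) (.seq (.pop .data) pf))) (.seq (.pop .data) pg))), _,
    (((PolyBdd.const 18).mul .size).add (.const 5)).add (hbc.add
      ((hbf.add hbg).add (.const 4))), ?_⟩
  · dsimp only
    split <;> omega
  · intro a rest
    have h0 := hc a (code a ++ rest)
    have h1 : Exec (.ite .data (· == some true)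
        (.seq (.pop .data) (.seq (.pop .data) (.seq (.pop .data) pf))) (.seq (.pop .data) pg))
        (mk (code (c a) ++ (code a ++ rest)) [] [] [])
        (mk (code (if c a then f a else g a) ++ rest) [] [] []) (bf a + bg a + 4) := by
      cases c a
      · exact (Exec.ite_false (by simp) (.seq (.pop_data ..) (hg a rest))).weaken (by omega)
      · exact (Exec.ite_true (by simp) (.seq (.pop_data ..) (.seq (.pop_data ..)
          (.seq (.pop_data ..) (hf a rest))))).weaken (by omega)
    exact (Exec.dup (Coded.data a) rest).seq (h0.seq h1)

/-- Iteration of a polynomial-time function, the number of iterations being the length of a list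
(or a natural number), provided that the intermediate values stay polynomially bounded. -/
theorem iterate {c : α → γ} {init : α → σ} {step : σ → σ} (hc : PolyFn c) (hi : PolyFn init)
    (hs : PolyFn step)
    (hb : ∃ B : α → ℕ, PolyBdd B ∧
      ∀ a, ∀ i ≤ (Coded.data (c a)).spine, size (step^[i] (init a)) ≤ B a) :
    PolyFn fun a => step^[(Coded.data (c a)).spine] (init a) := by
  obtain ⟨hc1, pc, bc, hbc, hc⟩ := hc
  obtain ⟨hi1, pi, bi, hbi, hi⟩ := hi
  obtain ⟨hs1, ps, ⟨bs, hbs⟩⟩ := hs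
  obtain ⟨⟨qs, hqs⟩, hs⟩ := hbs
  obtain ⟨B, hB, hb⟩ := hb
  -- `D` bounds the size of the counter and `N` that of the state. One round costs one `drop`, two
  -- calls of `swap`, and `step`
  have loop : ∀ (N D : ℕ) (d : Data) (s : σ) (rest : List Bool), d.size ≤ D →
      (∀ i ≤ d.spine, size (step^[i] s) ≤ N) →
      Exec (.loop .data (· == some true) (.seq (.pop .data) (.seq .drop (.seq .swap
        (.seq ps .swap))))) (mk (d.code ++ (code s ++ rest)) [] [] [])
        (mk (Data.leaf.code ++ (code (step^[d.spine] s) ++ rest)) [] [] [])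
        (D * (41 * D + 34 * N + qs.eval N + 30) + 1) := by
    intro N D d s rest hD hN
    have key : Exec (.loop .data (· == some true) (.seq (.pop .data) (.seq .drop (.seq .swap
        (.seq ps .swap))))) (mk (d.code ++ (code s ++ rest)) [] [] [])
        (mk (Data.leaf.code ++ (code (step^[d.spine] s) ++ rest)) [] [] [])
        (d.spine * (41 * D + 34 * N + qs.eval N + 30) + 1) := by
      induction d generalizing s with
      | leaf =>
        have h0 : Exec (.loop .data (· == some true) (.seq (.pop .data) (.seq .drop (.seq .swap
          (.seq ps .swap))))) (mk (Data.leaf.code ++ (code s ++ rest)) [] [] [])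
          (mk (Data.leaf.code ++ (code s ++ rest)) [] [] []) 1 := .loop_done (by rfl)
        simpa [Data.spine] using h0
      | node l r _ ih =>
        simp only [Data.size_node] at hD
        have h0 : size s ≤ N := hN 0 (Nat.zero_le _)
        have h1 : size (step s) ≤ N := hN 1 (by simp [Data.spine])
        have h2 := ih (step s) (by omega) fun i hi => hN (i + 1) (by simp [Data.spine]; omega)
        have h3 := Exec.seq (.pop_data true (l.code ++ (r.code ++ (code s ++ rest))) [] [] [])
          (.seq (.drop l (r.code ++ (code s ++ rest)) []) (.seq (.swap r (Coded.data s) rest)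
            (.seq (hs s (r.code ++ rest)) (.swap (Coded.data (step s)) r rest))))
        have h4 := Exec.loop_step (f := (· == some true)) (by simp) h3 h2
        have e1 : (Data.node l r).code ++ (code s ++ rest) =
            true :: (l.code ++ (r.code ++ (code s ++ rest))) := by simp [Data.code]
        rw [e1]
        refine h4.weaken ?_
        have h5 : bs s ≤ qs.eval N := (hqs s).trans (eval_mono qs h0)
        change 1 + (7 * l.size + 3 + (17 * (r.size + size s) + 8 + (bs s +
          (17 * (size (step s) + r.size) + 8)))) + _ + 1 ≤ _
        simp only [Data.spine]
        have h6 := Nat.add_one_mul r.spine (41 * D + 34 * N + qs.eval N + 30)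
        omega
    refine key.weaken (Nat.add_le_add_right (Nat.mul_le_mul_right _ ?_) 1)
    exact (Data.spine_le_size d).trans hD
  have hqB : PolyBdd fun a => qs.eval (B a) := by
    obtain ⟨q', hq'⟩ := hB
    exact ⟨qs.comp q', fun a => by
      rw [Polynomial.eval_comp]
      exact eval_mono qs (hq' a)⟩
  refine ⟨hB.mono fun a => hb a _ le_rfl,
    .seq .dup (.seq pi (.seq .swap (.seq pc (.seq (.loop .data (· == some true)
      (.seq (.pop .data) (.seq .drop (.seq .swap (.seq ps .swap))))) (.pop .data))))), _,
    (((PolyBdd.const 18).mul .size).add (.const 5)).add (hbi.add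
      ((((PolyBdd.const 17).mul (hi1.add .size)).add (.const 8)).add (hbc.add
        (((hc1.mul (((((PolyBdd.const 41).mul hc1).add ((PolyBdd.const 34).mul hB)).add hqB).add
          (.const 30))).add (.const 1)).add (.const 1))))), ?_⟩
  intro a rest
  refine (Exec.dup (Coded.data a) rest).seq ((hi a (code a ++ rest)).seq ?_)
  refine (Exec.swap (Coded.data (init a)) (Coded.data a) rest).seq ?_
  refine (hc a (code (init a) ++ rest)).seq (.seq ?_ (.pop_data false _ [] [] []))
  exact loop (B a) (size (c a)) (Coded.data (c a)) (init a) rest le_rfl (hb a)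

end PolyFn

/-! ### Strings as lists of truth values -/

namespace Prog

/-- Convert the string on `aux` to a tree on `data`. -/
def readInput : Prog :=
  .seq (transfer .aux .spare) (.seq (.push .data false)
    (.loop .spare Option.isSome (.ite .spare (· == some true)
      (.seq (.pop .spare) (write [true, true, false, false]))
      (.seq (.pop .spare) (write [true, false])))))

/-- Convert a tree on `data` to a string on `aux`. -/
def writeOutput : Prog :=
  .seq (.loop .data (· == some true) (.seq (.pop .data) (.ite .data (· == some true)
      (.seq (.pop .data) (.seq (.pop .data) (.seq (.pop .data) (.push .aux true))))
      (.seq (.pop .data) (.push .aux false)))))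
    (.seq (.pop .data) (.seq (transfer .aux .spare) (.seq (transfer .spare .depth)
      (transfer .depth .aux))))

end Prog

theorem Exec.readInput (w : List Bool) :
    Exec .readInput (mk [] w [] []) (mk (code w) [] [] []) (13 * w.length + 3) := by
  have loop : ∀ u v : List Bool, Exec (.loop .spare Option.isSome (.ite .spare (· == some true)
      (.seq (.pop .spare) (.write [true, true, false, false]))
      (.seq (.pop .spare) (.write [true, false])))) (mk (code v) [] u [])
      (mk (code (u.reverse ++ v)) [] [] []) (8 * u.length + 1) := by
    intro u
    induction u with
    | nil => exact fun v => .loop_done (by simp)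
    | cons b u ih =>
      intro v
      have h := ih (b :: v)
      rw [List.reverse_cons, List.append_assoc, List.singleton_append]
      cases b
      · refine (Exec.loop_step (by simp) (.ite_false (by simp) (.seq (.pop_spare ..)
          (.write ..))) h).weaken ?_
        simp only [List.length_cons, List.length_nil]
        omega
      · refine (Exec.loop_step (by simp) (.ite_true (by simp) (.seq (.pop_spare ..)
          (.write ..))) h).weaken ?_
        simp only [List.length_cons, List.length_nil]
        omega
  have h := loop w.reverse []
  simp only [List.reverse_reverse, List.append_nil, code_nil] at h
  have h1 := Exec.aux_spare [] w [] []
  rw [List.append_nil] at h1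
  refine (h1.seq (.seq (.push_data ..) h)).weaken ?_
  simp only [List.length_reverse]
  omega

theorem Exec.writeOutput (w : List Bool) :
    Exec .writeOutput (mk (code w) [] [] []) (mk [] w [] []) (19 * w.length + 5) := by
  have loop : ∀ u v : List Bool, Exec (.loop .data (· == some true) (.seq (.pop .data)
      (.ite .data (· == some true)
        (.seq (.pop .data) (.seq (.pop .data) (.seq (.pop .data) (.push .aux true))))
        (.seq (.pop .data) (.push .aux false))))) (mk (code u) v [] [])
      (mk [false] (u.reverse ++ v) [] []) (7 * u.length + 1) := by
    intro u
    induction u with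
    | nil => exact fun v => .loop_done (by simp)
    | cons b u ih =>
      intro v
      have h := ih (b :: v)
      rw [List.reverse_cons, List.append_assoc, List.singleton_append]
      cases b
      · refine (Exec.loop_step (by simp) (.seq (.pop_data ..) (.ite_false (by simp)
          (.seq (.pop_data ..) (.push_aux ..)))) h).weaken ?_
        simp only [List.length_cons]
        omega
      · refine (Exec.loop_step (by simp) (.seq (.pop_data ..) (.ite_true (by simp)
          (.seq (.pop_data ..) (.seq (.pop_data ..) (.seq (.pop_data ..) (.push_aux ..)))))) h).weaken ?_
        simp only [List.length_cons]
        omega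
  have h := (loop w []).seq (.seq (.pop_data ..) (.seq (.aux_spare ..) (.seq (.spare_depth ..)
    (.depth_aux ..))))
  simp only [List.append_nil, List.reverse_reverse] at h
  refine h.weaken ?_
  simp only [List.length_reverse]
  omega

theorem size_bits_le (w : List Bool) : size w ≤ 4 * w.length + 1 := by
  induction w with
  | nil => simp
  | cons b w ih =>
    have := size_bool_le b
    simp only [size_cons, List.length_cons]
    omega

/-- Functions on strings that are polynomial-time functions on lists are computable in polynomial
time by Turing machines. -/
theorem PolyFn.computableInPolyTime {β : Type} {eb : β → List Bool} {g : List Bool → β}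
    (h : PolyFn fun w => eb (g w)) :
    Nonempty (TM2ComputableInPolyTime (id : List Bool → List Bool) eb g) := by
  obtain ⟨⟨q, hq⟩, p, b, ⟨q', hq'⟩, hp⟩ := h
  refine computableInPolyTime_of_exec (.seq .readInput (.seq p .writeOutput))
    ((13 * Polynomial.X + 3) + (q'.comp (4 * Polynomial.X + 1) +
      (19 * q.comp (4 * Polynomial.X + 1) + 5))) eb g fun w => ?_
  have h1 := hp w []
  rw [List.append_nil, List.append_nil] at h1
  refine ((Exec.readInput w).seq (h1.seq (.writeOutput _))).weaken ?_
  have h2 : b w ≤ q'.eval (4 * w.length + 1) := (hq' w).trans (eval_mono _ (size_bits_le w))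
  have h3 : (eb (g w)).length ≤ q.eval (4 * w.length + 1) :=
    (length_le_size _).trans ((hq w).trans (eval_mono _ (size_bits_le w)))
  simp only [Polynomial.eval_add, Polynomial.eval_mul, Polynomial.eval_X, Polynomial.eval_comp,
    Polynomial.eval_one, Polynomial.eval_ofNat]
  omega

end StackMachine

namespace StackMachine

open Function

/-! ### A library of polynomial-time functions -/

theorem size_drop_le {β : Type} [Coded β] (t : List β) (i : ℕ) : size (t.drop i) ≤ size t := by
  induction i generalizing t with
  | zero => simp
  | succ i ih =>
    cases t with
    | nil => simp
    | cons b t => simpa using (ih t).trans (by omega)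

theorem PolyBdd.of_mem {α β : Type} [Coded α] [Coded β] {b : α × β → ℕ} {l : α → List β}
    (hb : PolyBdd b) (hl : PolyBdd fun a => StackMachine.size (l a)) :
    ∃ B : α → ℕ, PolyBdd B ∧ ∀ a, ∀ x ∈ l a, b (a, x) ≤ B a := by
  obtain ⟨q, hq⟩ := hb
  obtain ⟨q', hq'⟩ := (PolyBdd.size.add hl).add (.const 1)
  refine ⟨fun a => (q.comp q').eval (StackMachine.size a), ⟨_, fun a => le_rfl⟩, fun a x hx => ?_⟩
  simp only [Polynomial.eval_comp]
  refine (hq _).trans (eval_mono q (le_trans ?_ (hq' a)))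
  have := size_mem_le hx
  simp only [size_pair]
  omega

namespace PolyFn

variable {α β γ σ : Type} [Coded α] [Coded β] [Coded γ] [Coded σ]

/-- Left fold over a list, where every step adds a polynomially bounded amount to the size of the
state. -/
theorem foldl {l : α → List β} {init : α → σ} {step : α → σ → β → σ} (hl : PolyFn l)
    (hi : PolyFn init) (hs : PolyFn fun p : α × (σ × β) => step p.1 p.2.1 p.2.2)
    (hg : ∃ B : α → ℕ, PolyBdd B ∧ ∀ a s, ∀ b ∈ l a, size (step a s b) ≤ size s + B a) :
    PolyFn fun a => (l a).foldl (step a) (init a) := by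
  obtain ⟨B, hB, hg⟩ := hg
  -- one step of a loop that consumes the list in the last component
  let next : α × (σ × List β) → α × (σ × List β) := fun p =>
    match p.2.2 with
    | [] => p
    | b :: t => (p.1, (step p.1 p.2.1 b, t))
  have hnext : PolyFn next :=
    casesList (l := fun p : α × (σ × List β) => p.2.2) (g := fun p => p)
      (h := fun p b t => (p.1, (step p.1 p.2.1 b, t))) snd.snd' .id
      (pair fst.fst' (pair (hs.comp (f := fun p : (α × (σ × List β)) × (β × List β) =>
        (p.1.1, (p.1.2.1, p.2.1))) (pair fst.fst' (pair fst.snd'.fst' snd.fst'))) snd.snd'))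
  have iter : ∀ (a : α) (i : ℕ) (s : σ) (t : List β),
      next^[i] (a, (s, t)) = (a, ((t.take i).foldl (step a) s, t.drop i)) := by
    intro a i
    induction i with
    | zero => intro s t; simp
    | succ i ih =>
      intro s t
      rw [iterate_succ_apply]
      cases t with
      | nil =>
        have : next (a, (s, [])) = (a, (s, [])) := rfl
        rw [this, ih]
        simp
      | cons b t =>
        have : next (a, (s, b :: t)) = (a, (step a s b, t)) := rfl
        rw [this, ih]
        simp
  have grow : ∀ (a : α) (t : List β) (s : σ), (∀ b ∈ t, b ∈ l a) →
      size (t.foldl (step a) s) ≤ size s + t.length * B a := by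
    intro a t
    induction t with
    | nil => intro s _; simp
    | cons b t ih =>
      intro s ht
      have h1 := ih (step a s b) fun c hc => ht c (List.mem_cons_of_mem _ hc)
      have h2 := hg a s b (ht b List.mem_cons_self)
      rw [List.foldl_cons, List.length_cons, Nat.add_one_mul]
      omega
  have h := iterate (c := l) (init := fun a => (a, (init a, l a))) (step := next) hl
    (pair .id (pair hi hl)) hnext ⟨_, ((PolyBdd.size.add (hl.polyBdd.add (hi.polyBdd.add
      (hl.polyBdd.mul hB)))).add (.const 2)), fun a i _ => by
        rw [iter]
        simp only [size_pair]
        have h1 := grow a ((l a).take i) (init a) fun b hb => List.mem_of_mem_take hb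
        have h2 : ((l a).take i).length * B a ≤ size (l a) * B a :=
          Nat.mul_le_mul_right _ ((List.length_take_le' i _).trans (length_le_size _))
        have h3 := size_drop_le (l a) i
        omega⟩
  have : (fun a => (l a).foldl (step a) (init a)) =
      fun a => (next^[(Coded.data (l a)).spine] (a, (init a, l a))).2.1 := by
    funext a
    rw [iter, spine_list, List.take_length]
  rw [this]
  exact h.snd'.fst'

/-! #### Truth values -/

theorem not {f : α → Bool} (hf : PolyFn f) : PolyFn fun a => !f a := by
  have := ite hf (const (α := α) false) (const true)
  exact (congrArg PolyFn (funext fun a => by cases f a <;> rfl)).mp this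

theorem and {f g : α → Bool} (hf : PolyFn f) (hg : PolyFn g) : PolyFn fun a => f a && g a := by
  have := ite hf hg (const (α := α) false)
  exact (congrArg PolyFn (funext fun a => by cases f a <;> rfl)).mp this

theorem or {f g : α → Bool} (hf : PolyFn f) (hg : PolyFn g) : PolyFn fun a => f a || g a := by
  have := ite hf (const (α := α) true) hg
  exact (congrArg PolyFn (funext fun a => by cases f a <;> rfl)).mp this

/-! #### Lists -/

theorem cons {f : α → β} {l : α → List β} (hf : PolyFn f) (hl : PolyFn l) :
    PolyFn fun a => f a :: l a :=
  (of_code_eq (f := fun p : β × List β => p.1 :: p.2) fun _ => rfl).comp (pair hf hl)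

theorem reverse {l : α → List β} (hl : PolyFn l) : PolyFn fun a => (l a).reverse := by
  have := foldl (step := fun _ (s : List β) b => b :: s) hl (const (α := α) [])
    (cons snd.snd' snd.fst') ⟨_, hl.polyBdd.add (.const 1), fun a s b hb => by
      have := size_mem_le hb
      simp only [size_cons]
      omega⟩
  simpa using this

theorem append {l l' : α → List β} (hl : PolyFn l) (hl' : PolyFn l') :
    PolyFn fun a => l a ++ l' a := by
  have := foldl (step := fun _ (s : List β) b => b :: s) hl.reverse hl'
    (cons snd.snd' snd.fst') ⟨_, hl.polyBdd.add (.const 1), fun a s b hb => by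
      have := size_mem_le (List.mem_reverse.1 hb)
      simp only [size_cons]
      omega⟩
  simpa using this

theorem flatMap {l : α → List β} {f : α → β → List γ} (hl : PolyFn l)
    (hf : PolyFn fun p : α × β => f p.1 p.2) : PolyFn fun a => (l a).flatMap (f a) := by
  obtain ⟨B, hB, h⟩ := PolyBdd.of_mem hf.polyBdd hl.polyBdd
  have := foldl (step := fun a (s : List γ) b => s ++ f a b) hl (const (α := α) [])
    (append snd.fst' (hf.comp (f := fun p : α × (List γ × β) => (p.1, p.2.2)) (pair fst snd.snd')))
    ⟨B, hB, fun a s b hb => by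
      have h1 := h a b hb
      have h2 := size_append s (f a b)
      dsimp only at h1
      omega⟩
  refine (congrArg PolyFn (funext fun a => ?_)).mp this
  have : ∀ (t : List β) (s : List γ), t.foldl (fun s b => s ++ f a b) s = s ++ t.flatMap (f a) := by
    intro t
    induction t with
    | nil => simp
    | cons b t ih => intro s; simp [ih]
  simpa using this (l a) []

theorem map {l : α → List β} {f : α → β → γ} (hl : PolyFn l)
    (hf : PolyFn fun p : α × β => f p.1 p.2) : PolyFn fun a => (l a).map (f a) := by
  have := flatMap (f := fun a b => [f a b]) hl (cons hf (const []))
  refine (congrArg PolyFn (funext fun a => ?_)).mp this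
  generalize l a = t
  induction t with
  | nil => rfl
  | cons b t ih => simp [ih]

theorem filter {l : α → List β} {f : α → β → Bool} (hl : PolyFn l)
    (hf : PolyFn fun p : α × β => f p.1 p.2) : PolyFn fun a => (l a).filter (f a) := by
  have := flatMap (f := fun a b => if f a b then [b] else []) hl
    (ite hf (cons snd (const [])) (const []))
  refine (congrArg PolyFn (funext fun a => ?_)).mp this
  generalize l a = t
  induction t with
  | nil => rfl
  | cons b t ih => rw [List.flatMap_cons, ih, List.filter_cons]; split <;> simp

theorem any {l : α → List β} {f : α → β → Bool} (hl : PolyFn l)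
    (hf : PolyFn fun p : α × β => f p.1 p.2) : PolyFn fun a => (l a).any (f a) := by
  have := foldl (step := fun a s b => s || f a b) hl (const (α := α) false)
    (or snd.fst' (hf.comp (f := fun p : α × (Bool × β) => (p.1, p.2.2)) (pair fst snd.snd')))
    ⟨_, .const 3, fun a s b _ => (size_bool_le _).trans (Nat.le_add_left _ _)⟩
  refine (congrArg PolyFn (funext fun a => ?_)).mp this
  have : ∀ (t : List β) (s : Bool), t.foldl (fun s b => s || f a b) s = (s || t.any (f a)) := by
    intro t
    induction t with
    | nil => simp
    | cons b t ih => intro s; rw [List.foldl_cons, ih, List.any_cons, Bool.or_assoc]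
  simpa using this (l a) false

theorem headD {l : α → List β} (d : β) (hl : PolyFn l) : PolyFn fun a => (l a).headD d := by
  have := casesList (g := fun _ => d) (h := fun _ b _ => b) hl (const d) snd.fst'
  refine (congrArg PolyFn (funext fun a => ?_)).mp this
  cases l a <;> rfl

theorem tail {l : α → List β} (hl : PolyFn l) : PolyFn fun a => (l a).tail := by
  have := casesList (g := fun _ => []) (h := fun _ _ t => t) hl (const []) snd.snd'
  refine (congrArg PolyFn (funext fun a => ?_)).mp this
  cases l a <;> rfl

theorem isEmpty {l : α → List β} (hl : PolyFn l) : PolyFn fun a => (l a).isEmpty := by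
  have := casesList (g := fun _ => true) (h := fun _ _ _ => false) hl (const true) (const false)
  refine (congrArg PolyFn (funext fun a => ?_)).mp this
  cases l a <;> rfl

/-! #### Natural numbers in unary -/

theorem replicate {f : α → ℕ} (hf : PolyFn f) : PolyFn fun a => List.replicate (f a) () :=
  (of_code_eq (f := fun n : ℕ => List.replicate n ()) fun _ => rfl).comp hf

theorem length_unit {l : α → List Unit} (hl : PolyFn l) : PolyFn fun a => (l a).length :=
  (of_code_eq (f := fun l : List Unit => l.length) fun l => by
    change Coded.data (List.replicate l.length ()) = _
    congr 1
    exact (List.eq_replicate_length.2 fun _ _ => rfl).symm).comp hl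

theorem length {l : α → List β} (hl : PolyFn l) : PolyFn fun a => (l a).length := by
  simpa using length_unit (map (f := fun _ _ => ()) hl (const ()))

theorem succ {f : α → ℕ} (hf : PolyFn f) : PolyFn fun a => f a + 1 := by
  simpa using length_unit (cons (const ()) hf.replicate)

theorem add {f g : α → ℕ} (hf : PolyFn f) (hg : PolyFn g) : PolyFn fun a => f a + g a := by
  simpa using length_unit (hf.replicate.append hg.replicate)

theorem mul {f g : α → ℕ} (hf : PolyFn f) (hg : PolyFn g) : PolyFn fun a => f a * g a := by
  simpa using length_unit (flatMap (f := fun a _ => List.replicate (g a) ()) hf.replicate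
    (hg.replicate.comp fst))

theorem pow {f : α → ℕ} (hf : PolyFn f) (k : ℕ) : PolyFn fun a => f a ^ k := by
  induction k with
  | zero => simpa using const 1
  | succ k ih => simpa [pow_succ] using ih.mul hf

/-- Iteration with a number of rounds given in unary, where every round adds a polynomially bounded
amount to the size of the state. -/
theorem natIterate {c : α → ℕ} {init : α → σ} {step : α → σ → σ} (hc : PolyFn c)
    (hi : PolyFn init) (hs : PolyFn fun p : α × σ => step p.1 p.2)
    (hg : ∃ B : α → ℕ, PolyBdd B ∧ ∀ a s, size (step a s) ≤ size s + B a) :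
    PolyFn fun a => (step a)^[c a] (init a) := by
  obtain ⟨B, hB, hg⟩ := hg
  have := foldl (step := fun a s (_ : Unit) => step a s) hc.replicate hi
    (hs.comp (f := fun p : α × (σ × Unit) => (p.1, p.2.1)) (pair fst snd.fst'))
    ⟨B, hB, fun a s _ _ => hg a s⟩
  refine (congrArg PolyFn (funext fun a => ?_)).mp this
  generalize init a = s
  generalize c a = n
  induction n generalizing s with
  | zero => rfl
  | succ n ih => rw [List.replicate_succ, List.foldl_cons, ih, iterate_succ_apply]

theorem drop {f : α → ℕ} {l : α → List β} (hf : PolyFn f) (hl : PolyFn l) :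
    PolyFn fun a => (l a).drop (f a) := by
  have := natIterate (step := fun _ (s : List β) => s.tail) hf hl snd.tail
    ⟨_, .const 0, fun a s => by cases s <;> simp; omega⟩
  refine (congrArg PolyFn (funext fun a => ?_)).mp this
  generalize l a = s
  generalize f a = n
  induction n generalizing s with
  | zero => rfl
  | succ n ih => rw [iterate_succ_apply, ih, List.drop_tail]

theorem sub {f g : α → ℕ} (hf : PolyFn f) (hg : PolyFn g) : PolyFn fun a => f a - g a := by
  simpa using length_unit (hg.drop hf.replicate)

theorem getD {f : α → ℕ} {l : α → List β} (d : β) (hf : PolyFn f) (hl : PolyFn l) :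
    PolyFn fun a => (l a).getD (f a) d := by
  refine (congrArg PolyFn (funext fun a => ?_)).mp (headD d (hf.drop hl))
  rw [List.headD_eq_head?_getD, List.head?_drop, List.getD_eq_getElem?_getD]

theorem decide_le {f g : α → ℕ} (hf : PolyFn f) (hg : PolyFn g) :
    PolyFn fun a => decide (f a ≤ g a) := by
  refine (congrArg PolyFn (funext fun a => ?_)).mp (hf.sub hg).replicate.isEmpty
  rw [Bool.eq_iff_iff]
  simp [Nat.sub_eq_zero_iff_le]

theorem decide_lt {f g : α → ℕ} (hf : PolyFn f) (hg : PolyFn g) :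
    PolyFn fun a => decide (f a < g a) := hf.succ.decide_le hg

theorem decide_eq {f g : α → ℕ} (hf : PolyFn f) (hg : PolyFn g) :
    PolyFn fun a => decide (f a = g a) := by
  refine (congrArg PolyFn (funext fun a => ?_)).mp ((hf.decide_le hg).and (hg.decide_le hf))
  rw [Bool.eq_iff_iff]
  simp [le_antisymm_iff]

theorem range {f : α → ℕ} (hf : PolyFn f) : PolyFn fun a => List.range (f a) := by
  -- the number of elements listed so far is cut off at `f a` to bound the growth of the list
  have := natIterate (step := fun a (s : List ℕ) => (f a - (f a - s.length)) :: s) hf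
    (const (α := α) []) (cons ((hf.comp fst).sub ((hf.comp fst).sub snd.length)) snd)
    ⟨_, hf.polyBdd.add (.const 1), fun a s => by
      simp only [size_cons, size_nat]
      omega⟩
  refine (congrArg PolyFn (funext fun a => ?_)).mp this.reverse
  have : ∀ n ≤ f a, (fun s : List ℕ => (f a - (f a - s.length)) :: s)^[n] [] =
      (List.range n).reverse := by
    intro n
    induction n with
    | zero => intro _; rfl
    | succ n ih =>
      intro hn
      rw [iterate_succ_apply', ih (by omega), List.range_succ, List.reverse_append,
        List.length_reverse, List.length_range, Nat.sub_sub_self (by omega)]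
      rfl
  rw [this _ le_rfl, List.reverse_reverse]

theorem countP {l : α → List β} {f : α → β → Bool} (hl : PolyFn l)
    (hf : PolyFn fun p : α × β => f p.1 p.2) : PolyFn fun a => (l a).countP (f a) := by
  simpa [List.countP_eq_length_filter] using (hl.filter hf).length

/-! #### Finite families -/

theorem sum {ι : Type} (s : Finset ι) {f : ι → α → ℕ} (hf : ∀ i, PolyFn (f i)) :
    PolyFn fun a => ∑ i ∈ s, f i a := by
  classical
  induction s using Finset.induction_on with
  | empty => simpa using const 0
  | insert i s hi ih => simpa [Finset.sum_insert hi] using (hf i).add ih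

theorem constAll {ι : Type} (l : List ι) {f : ι → α → Bool} (hf : ∀ i, PolyFn (f i)) :
    PolyFn fun a => l.all fun i => f i a := by
  induction l with
  | nil => simpa using const true
  | cons i l ih => simpa using (hf i).and ih

theorem constFlatMap {ι : Type} (l : List ι) {f : ι → α → List β} (hf : ∀ i, PolyFn (f i)) :
    PolyFn fun a => l.flatMap fun i => f i a := by
  induction l with
  | nil => simpa using const []
  | cons i l ih => simpa using (hf i).append ih

end PolyFn

end StackMachine

/-! ### Thinning out a family of constraints -/

namespace Thinning

/-- The number of constraints, agreeing on all but `i` positions, that a thinned-out family may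
contain. A set of size `k` that avoids the common part of that many of them cannot hit them
all. -/
def capacity (k : ℕ) : ℕ → ℕ
  | 0 => 1
  | i + 1 => (i + 1) * k * capacity k i + 1

theorem exists_capacity_le (m : ℕ) : ∃ C, ∀ k, capacity k m ≤ C * (k + 1) ^ m := by
  induction m with
  | zero => exact ⟨1, fun k => le_rfl⟩
  | succ m ih =>
    obtain ⟨C, hC⟩ := ih
    refine ⟨(m + 1) * C + 1, fun k => ?_⟩
    calc (m + 1) * k * capacity k m + 1
        ≤ (m + 1) * (k + 1) * (C * (k + 1) ^ m) + (k + 1) ^ (m + 1) :=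
          add_le_add (Nat.mul_le_mul (Nat.mul_le_mul_left _ (Nat.le_succ k)) (hC k))
            (Nat.one_le_pow _ _ (Nat.succ_pos k))
      _ = ((m + 1) * C + 1) * (k + 1) ^ (m + 1) := by ring

theorem countP_le_sum {X ι : Type} (l : List X) (s : Finset ι) (p : X → Bool) (q : ι → X → Bool)
    (h : ∀ x ∈ l, p x → ∃ i ∈ s, q i x) : l.countP p ≤ ∑ i ∈ s, l.countP (q i) := by
  induction l with
  | nil => simp
  | cons a l ih =>
    have h1 := ih fun x hx => h x (List.mem_cons_of_mem _ hx)
    simp only [List.countP_cons, Finset.sum_add_distrib]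
    refine add_le_add h1 ?_
    split
    · rename_i hp
      obtain ⟨i, hi, hq⟩ := h a List.mem_cons_self hp
      calc 1 = if q i a = true then 1 else 0 := by simp [hq]
        _ ≤ _ := Finset.single_le_sum (f := fun i => if q i a = true then 1 else 0)
          (fun _ _ => Nat.zero_le _) hi
    · exact Nat.zero_le _

section

variable {X V : Type} [DecidableEq V] {m : ℕ} (val : X → Fin m → V) (k : ℕ) (act : X → Bool)

/-- The constraints `x` and `y` agree at the positions in `P`. -/
def agree (P : Finset (Fin m)) (x y : X) : Bool := decide (∀ j ∈ P, val x j = val y j)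

/-- There is room for the constraint `x` in the family `acc`. -/
noncomputable def hasRoom (acc : List X) (x : X) : Bool :=
  (Finset.univ : Finset (Finset (Fin m))).toList.all fun P =>
    decide (acc.countP (agree val P x) < capacity k (m - P.card))

/-- Add the constraint `x` to the family `acc` if it is active and there is room for it. -/
noncomputable def thinStep (acc : List X) (x : X) : List X :=
  if act x && hasRoom val k acc x then x :: acc else acc

/-- A small subfamily of the active members of a list of constraints, chosen greedily. The
constraint `x` asks of a set that it contains one of the values `val x j`. -/
noncomputable def thin (l : List X) : List X := l.foldl (thinStep val k act) []

variable {val k act}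

theorem hasRoom_iff {acc : List X} {x : X} : hasRoom val k acc x ↔
    ∀ P : Finset (Fin m), acc.countP (agree val P x) < capacity k (m - P.card) := by
  simp [hasRoom]

theorem agree_iff {P : Finset (Fin m)} {x y : X} :
    agree val P x y ↔ ∀ j ∈ P, val x j = val y j := by
  simp [agree]

theorem agree_congr {P : Finset (Fin m)} {x y : X} (h : agree val P x y) :
    agree val P x = agree val P y := by
  funext z
  rw [Bool.eq_iff_iff, agree_iff, agree_iff]
  rw [agree_iff] at h
  exact forall₂_congr fun j hj => by rw [h j hj]

/-- No part of a constraint is shared by too many members of the family. -/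
def Sparse (val : X → Fin m → V) (k : ℕ) (acc : List X) : Prop :=
  ∀ (P : Finset (Fin m)) (x : X), acc.countP (agree val P x) ≤ capacity k (m - P.card)

theorem Sparse.thinStep {acc : List X} (h : Sparse val k acc) (x : X) :
    Sparse val k (thinStep val k act acc x) := by
  unfold Thinning.thinStep
  split
  · rename_i hx
    rw [Bool.and_eq_true, hasRoom_iff] at hx
    intro P y
    rw [List.countP_cons]
    split
    · rename_i hyx
      rw [agree_congr hyx]
      exact hx.2 P
    · exact h P y
  · exact h

theorem sparse_thin (l : List X) : Sparse val k (thin val k act l) := by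
  have : ∀ (l acc : List X), Sparse val k acc → Sparse val k (l.foldl (thinStep val k act) acc) := by
    intro l
    induction l with
    | nil => exact fun _ h => h
    | cons x l ih => exact fun acc h => ih _ (h.thinStep x)
  exact this l [] fun P x => Nat.zero_le _

theorem length_thin_le (l : List X) : (thin val k act l).length ≤ capacity k m := by
  rcases hl : thin val k act l with _ | ⟨x, t⟩
  · exact Nat.zero_le _
  · have h := sparse_thin (val := val) (k := k) (act := act) l ∅ x
    rw [hl, Finset.card_empty, Nat.sub_zero] at h
    refine le_trans (le_of_eq ?_) h
    rw [eq_comm, List.countP_eq_length]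
    exact fun y _ => agree_iff.2 (by simp)

theorem mem_of_mem_thin {l : List X} {x : X} (h : x ∈ thin val k act l) : x ∈ l ∧ act x := by
  have : ∀ (l acc : List X), x ∈ l.foldl (thinStep val k act) acc →
      x ∈ acc ∨ (x ∈ l ∧ act x) := by
    intro l
    induction l with
    | nil => exact fun _ h => .inl h
    | cons y l ih =>
      intro acc h
      rcases ih _ h with h | h
      · unfold thinStep at h
        split at h
        · rename_i hy
          rcases List.mem_cons.1 h with rfl | h
          · exact .inr ⟨List.mem_cons_self, (Bool.and_eq_true _ _ ▸ hy).1⟩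
          · exact .inl h
        · exact .inl h
      · exact .inr ⟨List.mem_cons_of_mem _ h.1, h.2⟩
  simpa using this l [] h

/-- An active constraint that is not chosen shares one of its parts with as many members of the
family as allowed. -/
theorem mem_thin_or {l : List X} {x : X} (hx : x ∈ l) (ha : act x) : x ∈ thin val k act l ∨
    ∃ P : Finset (Fin m), capacity k (m - P.card) ≤ (thin val k act l).countP (agree val P x) := by
  have step : ∀ (y : X) (acc : List X), acc.Sublist (thinStep val k act acc y) := by
    intro y acc
    unfold thinStep
    split
    · exact List.sublist_cons_self _ _
    · exact List.Sublist.refl _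
  have sub : ∀ (l acc : List X), acc.Sublist (l.foldl (thinStep val k act) acc) := by
    intro l
    induction l with
    | nil => exact fun acc => List.Sublist.refl _
    | cons y l ih => exact fun acc => (step y acc).trans (ih _)
  have : ∀ (l acc : List X), x ∈ l → x ∈ l.foldl (thinStep val k act) acc ∨
      ∃ P : Finset (Fin m), capacity k (m - P.card) ≤
        (l.foldl (thinStep val k act) acc).countP (agree val P x) := by
    intro l
    induction l with
    | nil => exact fun _ h => absurd h List.not_mem_nil
    | cons y l ih =>
      intro acc h
      rcases List.mem_cons.1 h with rfl | h
      · by_cases hr : hasRoom val k acc x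
        · refine .inl ((sub l _).subset ?_)
          unfold thinStep
          rw [ha, hr]
          exact List.mem_cons_self
        · rw [hasRoom_iff] at hr
          push Not at hr
          obtain ⟨P, hP⟩ := hr
          exact .inr ⟨P, hP.trans (((step x acc).trans (sub l _)).countP_le)⟩
      · exact ih _ h
  exact this l [] hx

/-- A set of size at most `k` that satisfies the chosen constraints satisfies all active ones. -/
theorem hits_of_hits_thin {l : List X} {S : Finset V} (hS : S.card ≤ k)
    (h : ∀ x ∈ thin val k act l, ∃ j, val x j ∈ S) {x : X} (hx : x ∈ l) (ha : act x) :
    ∃ j, val x j ∈ S := by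
  rcases mem_thin_or (val := val) (k := k) hx ha with hx | ⟨P, hP⟩
  · exact h x hx
  by_contra! hno
  have hsp := sparse_thin (val := val) (k := k) (act := act) l
  revert hP h hsp
  generalize thin val k act l = acc
  intro h hP hsp
  -- the members that agree with `x` on `P` are hit outside `P`
  have h1 := countP_le_sum acc (Pᶜ ×ˢ S) (agree val P x)
    (fun p y => agree val P x y && decide (val y p.1 = p.2)) (by
      intro y hy hxy
      obtain ⟨j, hj⟩ := h y hy
      refine ⟨(j, val y j), ?_, by simp [hxy]⟩
      rw [Finset.mem_product, Finset.mem_compl]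
      refine ⟨fun hjP => hno j ?_, hj⟩
      rw [agree_iff.1 hxy j hjP]
      exact hj)
  have h2 : ∀ p ∈ Pᶜ ×ˢ S, acc.countP (fun y => agree val P x y && decide (val y p.1 = p.2)) ≤
      capacity k (m - (P.card + 1)) := by
    rintro ⟨j, v⟩ hp
    rw [Finset.mem_product, Finset.mem_compl] at hp
    by_cases hz : ∃ y₀ ∈ acc, (agree val P x y₀ && decide (val y₀ j = v)) = true
    · obtain ⟨y₀, -, hy₀⟩ := hz
      rw [Bool.and_eq_true, decide_eq_true_iff] at hy₀
      refine le_trans (List.countP_mono_left fun y _ hy => ?_)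
        (Finset.card_insert_of_notMem hp.1 ▸ hsp (insert j P) y₀)
      rw [Bool.and_eq_true, decide_eq_true_iff] at hy
      rw [agree_iff]
      intro i hi
      rcases Finset.mem_insert.1 hi with rfl | hi
      · rw [hy₀.2, hy.2]
      · rw [← agree_iff.1 hy₀.1 i hi, agree_iff.1 hy.1 i hi]
    · push Not at hz
      rw [List.countP_eq_zero.2 hz]
      exact Nat.zero_le _
  have h3 := h1.trans (Finset.sum_le_card_nsmul _ _ _ h2)
  rw [Finset.card_product, Finset.card_compl, Fintype.card_fin, smul_eq_mul] at h3
  have h4 := hP.trans h3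
  have hPm : P.card ≤ m := by simpa using Finset.card_le_univ P
  rcases hi : m - P.card with _ | i
  · rw [hi] at h4
    simp [capacity] at h4
  · rw [hi, show m - (P.card + 1) = i by omega, capacity] at h4
    have h5 := Nat.mul_le_mul_right (capacity k i) (Nat.mul_le_mul_left (i + 1) hS)
    omega

end

end Thinning

namespace StackMachine.PolyFn

variable {α X V : Type} [Coded α] [Coded X] [DecidableEq V]

theorem capacity {f : α → ℕ} (hf : PolyFn f) (i : ℕ) :
    PolyFn fun a => Thinning.capacity (f a) i := by
  induction i with
  | zero => exact const 1
  | succ i ih => exact (((const (i + 1)).mul hf).mul ih).succ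

theorem thin {m : ℕ} {val : X → Fin m → V} {k : α → ℕ} {act : α → X → Bool} {l : α → List X}
    (hk : PolyFn k) (hact : PolyFn fun p : α × X => act p.1 p.2) (hl : PolyFn l)
    (hval : ∀ P, PolyFn fun p : X × X => Thinning.agree val P p.1 p.2) :
    PolyFn fun a => Thinning.thin val (k a) (act a) (l a) := by
  refine foldl (step := fun a => Thinning.thinStep val (k a) (act a)) hl (const []) ?_
    ⟨_, hl.polyBdd.add (.const 1), fun a s b hb => ?_⟩
  · have h1 : PolyFn fun p : α × (List X × X) => act p.1 p.2.2 :=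
      hact.comp (f := fun p : α × (List X × X) => (p.1, p.2.2)) (pair fst snd.snd')
    have h2 : PolyFn fun p : α × (List X × X) => Thinning.hasRoom val (k p.1) p.2.1 p.2.2 :=
      constAll _ fun P => decide_lt
        (countP (f := fun p : α × (List X × X) => Thinning.agree val P p.2.2) snd.fst'
          ((hval P).comp (f := fun p : (α × (List X × X)) × X => (p.1.2.2, p.2))
            (pair fst.snd'.snd' snd)))
        ((hk.comp fst).capacity _)
    exact ite (h1.and h2) (cons snd.snd' snd.fst') snd.fst'
  · have := size_mem_le hb
    unfold Thinning.thinStep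
    split
    · simp only [size_cons]
      omega
    · omega

end StackMachine.PolyFn

namespace Kernelization

open Finset

/-! ### Codes of structures -/

/-- All tuples of length `k` over the list `L`; the first entry varies fastest. -/
def tuples {α : Type} (L : List α) : ℕ → List (List α)
  | 0 => [[]]
  | k + 1 => (tuples L k).flatMap fun w => L.map fun a => a :: w

theorem mem_tuples {α : Type} {L : List α} {k : ℕ} {x : List α} :
    x ∈ tuples L k ↔ x.length = k ∧ ∀ a ∈ x, a ∈ L := by
  induction k generalizing x with
  | zero =>
    simp only [tuples, List.mem_singleton, List.length_eq_zero_iff]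
    exact ⟨fun h => ⟨h, by simp [h]⟩, fun h => h.1⟩
  | succ k ih =>
    simp only [tuples, List.mem_flatMap, List.mem_map, ih]
    constructor
    · rintro ⟨w, ⟨h1, h2⟩, a, ha, rfl⟩
      simp only [List.length_cons, h1, List.mem_cons, true_and]
      rintro b (rfl | hb)
      exacts [ha, h2 b hb]
    · rintro ⟨h1, h2⟩
      rcases x with _ | ⟨a, w⟩
      · simp at h1
      · exact ⟨w, ⟨by simpa using h1, fun b hb => h2 b (List.mem_cons_of_mem _ hb)⟩, a,
          h2 a List.mem_cons_self, rfl⟩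

theorem length_tuples {α : Type} (L : List α) (k : ℕ) : (tuples L k).length = L.length ^ k := by
  induction k with
  | zero => rfl
  | succ k ih => simp [tuples, List.length_flatMap, ih, pow_succ]

theorem getElem?_flatMap_add_mul {α β : Type} {f : α → List β} {n : ℕ} (l : List α)
    (hf : ∀ a, (f a).length = n) {i : ℕ} (hi : i < n) (j : ℕ) :
    (l.flatMap f)[i + n * j]? = l[j]?.bind fun a => (f a)[i]? := by
  induction l generalizing j with
  | nil => simp
  | cons a l ih =>
    rw [List.flatMap_cons]
    cases j with
    | zero =>
      rw [List.getElem?_append_left (by rw [hf]; simpa using hi)]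
      simp
    | succ j =>
      rw [List.getElem?_append_right (by rw [hf, Nat.mul_succ]; omega), hf,
        show i + n * (j + 1) - n = i + n * j by rw [Nat.mul_succ]; omega, ih]
      simp

theorem getElem?_tuples {α : Type} (L : List α) {k : ℕ} (z : Fin k → Fin L.length) :
    (tuples L k)[∑ j, (z j : ℕ) * L.length ^ (j : ℕ)]? = some (List.ofFn fun j => L[z j]) := by
  induction k with
  | zero => simp [tuples]
  | succ k ih =>
    have h : ∑ j, (z j : ℕ) * L.length ^ (j : ℕ) =
        z 0 + L.length * ∑ j : Fin k, (z j.succ : ℕ) * L.length ^ (j : ℕ) := by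
      rw [Fin.sum_univ_succ, Finset.mul_sum]
      simp only [Fin.val_zero, pow_zero, mul_one, Fin.val_succ]
      congr 1
      refine Finset.sum_congr rfl fun j _ => ?_
      ring
    rw [h, tuples, getElem?_flatMap_add_mul _ (fun w => List.length_map _) (z 0).isLt,
      ih fun j => z j.succ]
    simp [List.ofFn_succ]

theorem getElem?_flatMap_sum {α β : Type} {f : α → List β} {l : List α} {v : List β} {q : ℕ} {a : α}
    (hq : l[q]? = some a) {p : ℕ} (hp : p < (f a).length) :
    (l.flatMap f ++ v)[((l.take q).map fun b => (f b).length).sum + p]? = (f a)[p]? := by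
  induction l generalizing q with
  | nil => simp at hq
  | cons b l ih =>
    rw [List.flatMap_cons, List.append_assoc]
    cases q with
    | zero =>
      simp only [List.getElem?_cons_zero, Option.some.injEq] at hq
      subst hq
      simp [List.getElem?_append_left hp]
    | succ q =>
      rw [List.getElem?_cons_succ] at hq
      rw [List.take_succ_cons, List.map_cons, List.sum_cons, add_assoc,
        List.getElem?_append_right (Nat.le_add_right _ _), Nat.add_sub_cancel_left, ih hq]

section Codes

variable {t : ℕ} (r : Fin t → ℕ)

/-- The code of the structure with universe `L` and relations `R`, followed by the bits `b`. -/
def assemble (L : List ℕ) (R : ∀ i, (Fin (r i) → ℕ) → Bool) (b : List Bool) : List Bool :=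
  List.replicate L.length false ++ true ::
    ((List.finRange t).flatMap (fun i => (tuples L (r i)).map fun z => R i fun j => z.getD j 0) ++ b)

variable {r}

theorem assemble_eq_encode (A : FinStruct r) {L : List ℕ} (hL : L.length = A.size)
    {R : ∀ i, (Fin (r i) → ℕ) → Bool}
    (hR : ∀ i (z : Fin (r i) → Fin L.length),
      R i (fun j => L[z j]) = decide ((fun j => Fin.cast hL (z j)) ∈ A.rel i)) (k : ℕ) :
    assemble r L R k.bits = A.encode k := by
  obtain ⟨n, rel⟩ := A
  dsimp only at hL
  subst hL
  unfold assemble FinStruct.encode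
  congr 3
  refine List.flatMap_congr fun i _ => ?_
  apply List.ext_getElem
  · rw [List.length_map, length_tuples, FinStruct.length_table]
  intro p h1 h2
  rw [FinStruct.length_table] at h2
  have hp : p = ∑ j, ((finFunctionFinEquiv.symm (⟨p, h2⟩ : Fin (L.length ^ r i)) j : Fin L.length) : ℕ)
      * L.length ^ (j : ℕ) := by
    have := finFunctionFinEquiv_apply
      (finFunctionFinEquiv.symm (⟨p, h2⟩ : Fin (L.length ^ r i)))
    rw [Equiv.apply_symm_apply] at this
    exact this
  have h3 := getElem?_tuples L (finFunctionFinEquiv.symm (⟨p, h2⟩ : Fin (L.length ^ r i)))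
  rw [← hp] at h3
  have h4 := hR i (finFunctionFinEquiv.symm (⟨p, h2⟩ : Fin (L.length ^ r i)))
  rw [List.length_map] at h1
  rw [List.getElem?_eq_getElem h1, Option.some.injEq] at h3
  rw [List.getElem_map, h3]
  simp only [FinStruct.table, List.getElem_ofFn]
  refine Eq.trans (congrArg (R i) (funext fun j => ?_)) h4
  simp

variable (r)

/-- The position at which the table of the `i`-th relation starts. -/
def offset (n : ℕ) (i : Fin t) : ℕ := (((List.finRange t).take i).map fun j => n ^ r j).sum

/-- The total length of the tables. -/
def tablesLength (n : ℕ) : ℕ := ((List.finRange t).map fun j => n ^ r j).sum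

/-- The entry of the table of the `i`-th relation for the tuple `z`, where `u` consists of the
tables for a universe of size `n`, possibly followed by other bits. -/
def lookup (n : ℕ) (u : List Bool) (i : Fin t) (z : Fin (r i) → ℕ) : Bool :=
  u.getD (offset r n i + ∑ j, z j * n ^ (j : ℕ)) false

variable {r}

theorem lookup_tables (A : FinStruct r) (v : List Bool) (i : Fin t) (z : Fin (r i) → Fin A.size) :
    lookup r A.size ((List.finRange t).flatMap A.table ++ v) i (fun j => z j) =
      decide (z ∈ A.rel i) := by
  have h1 : ∑ j, (z j : ℕ) * A.size ^ (j : ℕ) = finFunctionFinEquiv z :=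
    (finFunctionFinEquiv_apply z).symm
  have h2 : offset r A.size i =
      (((List.finRange t).take i).map fun j => (A.table j).length).sum := by
    simp only [offset, FinStruct.length_table]
  have h3 : (A.table i)[(finFunctionFinEquiv z : ℕ)]? = some (decide (z ∈ A.rel i)) := by
    unfold FinStruct.table
    rw [List.getElem?_ofFn, dif_pos (finFunctionFinEquiv z).isLt, Fin.eta,
      Equiv.symm_apply_apply]
  unfold lookup
  rw [List.getD_eq_getElem?_getD, h1, h2, getElem?_flatMap_sum (a := i) (by simp)
    (by rw [FinStruct.length_table]; exact (finFunctionFinEquiv z).isLt), h3]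
  rfl

theorem drop_tables (A : FinStruct r) (v : List Bool) :
    ((List.finRange t).flatMap A.table ++ v).drop (tablesLength r A.size) = v := by
  refine List.drop_left' ?_
  simp only [tablesLength, List.length_flatMap, FinStruct.length_table]

end Codes

/-- One step of reading the header of a code. The state records whether the separator has been
read, the number of symbols before it, and the symbols after it in reversed order. -/
def headerStep (s : Bool × (ℕ × List Bool)) (b : Bool) : Bool × (ℕ × List Bool) :=
  if s.1 then (true, (s.2.1, b :: s.2.2))
  else if b then (true, s.2) else (false, (s.2.1 + 1, s.2.2))

/-- The number of symbols of `w` before the separator. -/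
def universeSize (w : List Bool) : ℕ := (w.foldl headerStep (false, (0, []))).2.1

/-- The symbols of `w` after the separator. -/
def body (w : List Bool) : List Bool := (w.foldl headerStep (false, (0, []))).2.2.reverse

theorem foldl_headerStep (n : ℕ) (u : List Bool) :
    (List.replicate n false ++ true :: u).foldl headerStep (false, (0, [])) =
      (true, (n, u.reverse)) := by
  have h1 : ∀ (u v : List Bool) (m : ℕ),
      u.foldl headerStep (true, (m, v)) = (true, (m, u.reverse ++ v)) := by
    intro u
    induction u with
    | nil => simp
    | cons b u ih => intro v m; simp [headerStep, ih]
  have h2 : ∀ n m : ℕ, (List.replicate n false ++ true :: u).foldl headerStep (false, (m, [])) =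
      (true, (m + n, u.reverse)) := by
    intro n
    induction n with
    | zero => intro m; simp [headerStep, h1]
    | succ n ih =>
      intro m
      rw [List.replicate_succ, List.cons_append, List.foldl_cons,
        show headerStep (false, (m, [])) false = (false, (m + 1, [])) from rfl, ih]
      simp [add_comm, add_left_comm]
  simpa using h2 n 0

/-- The number with the given binary digits, least significant digit first. -/
def value (l : List Bool) : ℕ := l.foldr (fun b v => 2 * v + b.toNat) 0

/-- There are no leading zeros. -/
def canonical (l : List Bool) : Bool := l.reverse.headD true

theorem value_bits (k : ℕ) : value k.bits = k := by
  induction k using Nat.binaryRec' with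
  | zero => simp [value]
  | bit b n h ih =>
    rw [Nat.bits_append_bit n b h, value, List.foldr_cons]
    change 2 * value n.bits + b.toNat = _
    rw [ih, Nat.bit_val]

theorem canonical_cons (b : Bool) (l : List Bool) :
    canonical (b :: l) = if l = [] then b else canonical l := by
  unfold canonical
  rw [List.reverse_cons]
  rcases l.eq_nil_or_concat with rfl | ⟨l, c, rfl⟩
  · simp
  · simp

theorem canonical_bits (k : ℕ) : canonical k.bits = true := by
  induction k using Nat.binaryRec' with
  | zero => simp [canonical]
  | bit b n h ih =>
    rw [Nat.bits_append_bit n b h, canonical_cons]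
    split
    · rename_i hn
      refine h ?_
      rw [← value_bits n, hn]
      rfl
    · exact ih

theorem bits_value {l : List Bool} (h : canonical l = true) : (value l).bits = l := by
  induction l with
  | nil => simp [value]
  | cons b l ih =>
    rw [canonical_cons] at h
    have hv : value (b :: l) = Nat.bit b (value l) := by
      rw [Nat.bit_val]
      rfl
    split at h
    · rename_i hl
      subst hl
      subst h
      simp [value]
    · rename_i hl
      have hl' := ih h
      rw [hv, Nat.bits_append_bit, hl']
      intro h0
      rw [h0, Nat.zero_bits] at hl'
      exact absurd hl'.symm hl

/-- The minimum of `M` and the number with the given binary digits, computed without leaving the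
range up to `M`. -/
def cappedValue (M : ℕ) (l : List Bool) : ℕ :=
  l.reverse.foldl (fun v b => min M (2 * v + b.toNat)) 0

theorem cappedValue_eq (M : ℕ) (l : List Bool) : cappedValue M l = min M (value l) := by
  unfold cappedValue
  rw [List.foldl_reverse]
  induction l with
  | nil => simp [value]
  | cons b l ih =>
    rw [List.foldr_cons, ih]
    change _ = min M (2 * value l + b.toNat)
    omega

section Instances

variable {t : ℕ} (r : Fin t → ℕ)

/-- The last part of a code, which holds the bits of the parameter. -/
def paramBits (w : List Bool) : List Bool := (body w).drop (tablesLength r (universeSize w))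

/-- The relations that a string describes. -/
def relations (w : List Bool) (i : Fin t) (z : Fin (r i) → ℕ) : Bool :=
  lookup r (universeSize w) (body w) i z

/-- Whether a string is the code of an instance, tested by encoding what can be read off it. -/
def valid (w : List Bool) : Bool :=
  decide (w = assemble r (List.range (universeSize w)) (relations r w) (paramBits r w)) &&
    canonical (paramBits r w)

/-- The structure that a string describes. -/
def decode (w : List Bool) : FinStruct r where
  size := universeSize w
  rel i := {z | relations r w i (fun j => z j) = true}

variable {r}

theorem mem_rel_decode {w : List Bool} {i : Fin t} {z : Fin (r i) → Fin (universeSize w)} :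
    z ∈ (decode r w).rel i ↔ relations r w i (fun j => z j) = true :=
  mem_filter.trans (and_iff_right (mem_univ z))

theorem universeSize_encode (A : FinStruct r) (k : ℕ) : universeSize (A.encode k) = A.size := by
  rw [universeSize, FinStruct.encode, foldl_headerStep]

theorem body_encode (A : FinStruct r) (k : ℕ) :
    body (A.encode k) = (List.finRange t).flatMap A.table ++ k.bits := by
  rw [body, FinStruct.encode, foldl_headerStep, List.reverse_reverse]

theorem paramBits_encode (A : FinStruct r) (k : ℕ) : paramBits r (A.encode k) = k.bits := by
  rw [paramBits, body_encode, universeSize_encode, drop_tables]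

theorem valid_encode (A : FinStruct r) (k : ℕ) : valid r (A.encode k) = true := by
  rw [valid, paramBits_encode, canonical_bits, Bool.and_true, decide_eq_true_iff]
  refine (assemble_eq_encode A (by rw [List.length_range, universeSize_encode]) (fun i z => ?_) k).symm
  have h := lookup_tables A k.bits i fun j => Fin.cast (by
    rw [List.length_range, universeSize_encode]) (z j)
  have hz : (fun j => (List.range (universeSize (A.encode k)))[z j]) =
      fun j => ((Fin.cast (by rw [List.length_range, universeSize_encode]) (z j) :
        Fin A.size) : ℕ) := by
    funext j
    simp
  rw [← h, hz]
  generalize (fun j => ((Fin.cast _ (z j) : Fin A.size) : ℕ)) = y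
  rw [relations, universeSize_encode, body_encode]

theorem encode_decode {w : List Bool} (h : valid r w = true) :
    (decode r w).encode (value (paramBits r w)) = w := by
  rw [valid, Bool.and_eq_true, decide_eq_true_iff] at h
  conv_rhs => rw [h.1, ← bits_value h.2]
  refine (assemble_eq_encode _ (by rw [List.length_range]; rfl) (fun i z => ?_) _).symm
  rw [Bool.eq_iff_iff, decide_eq_true_iff]
  refine Iff.trans ?_ mem_rel_decode.symm
  simp

end Instances

/-! ### Substructures -/

section Semantics

variable {t : ℕ} {r : Fin t → ℕ} {cS cx : ℕ}

/-- The structure that is induced on `{0, …, n - 1}` by a map into the universe of `A`. -/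
def pullback (A : FinStruct r) {n : ℕ} (e : Fin n → Fin A.size) : FinStruct r where
  size := n
  rel i := {z | (fun j => e (z j)) ∈ A.rel i}

theorem mem_rel_pullback {A : FinStruct r} {n : ℕ} {e : Fin n → Fin A.size} {i : Fin t}
    {z : Fin (r i) → Fin n} : z ∈ (pullback A e).rel i ↔ (fun j => e (z j)) ∈ A.rel i :=
  mem_filter.trans (and_iff_right (mem_univ z))

theorem minWeight_le_iff (ψ : SCNF r cS cx) (A : FinStruct r) (k : ℕ) :
    ψ.minWeight A ≤ k ↔ ∃ S, ψ.Models A S ∧ S.card ≤ k := by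
  constructor
  · intro h
    by_contra! hno
    have : ((k + 1 : ℕ) : ℕ∞) ≤ ψ.minWeight A :=
      le_iInf fun S => by exact_mod_cast hno S.1 S.2
    have := this.trans h
    norm_cast at this
    omega
  · rintro ⟨S, hS, hk⟩
    exact (iInf_le (fun S : {S // ψ.Models A S} => (S.1.card : ℕ∞)) ⟨S, hS⟩).trans
      (by exact_mod_cast hk)

theorem holds_pullback {ψ : SCNF r cS cx} {A : FinStruct r} {n : ℕ} {e : Fin n → Fin A.size}
    {S : Finset (Fin cS → Fin A.size)} {S' : Finset (Fin cS → Fin n)}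
    (h : ∀ z, z ∈ S' ↔ (fun j => e (z j)) ∈ S) (x : Fin cx → Fin n) :
    ψ.Holds (pullback A e) S' x ↔ ψ.Holds A S fun v => e (x v) := by
  have key : ∀ l : SLiteral r cS cx, SLiteral.Holds (pullback A e) S' x l ↔
      SLiteral.Holds A S (fun v => e (x v)) l := by
    rintro ⟨b, a⟩
    have ha : a.Holds (pullback A e) S' x ↔ a.Holds A S fun v => e (x v) := by
      cases a with
      | rel i z => exact mem_rel_pullback
      | sol z => exact h _
    simp only [SLiteral.Holds, ha]
  simp only [SCNF.Holds, key]

/-- A part of the universe that contains enough constraints yields an equivalent instance: a small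
solution restricts to the part, and a small solution for the part is one for the whole. -/
theorem minWeight_pullback_le_iff {ψ : SCNF r cS cx} {A : FinStruct r} {n k : ℕ}
    {e : Fin n → Fin A.size} (he : Function.Injective e)
    (hsuff : ∀ S : Finset (Fin cS → Fin A.size), S.card ≤ k →
      (∀ x : Fin cx → Fin n, ψ.Holds A S fun v => e (x v)) → ψ.Models A S) :
    ψ.minWeight (pullback A e) ≤ k ↔ ψ.minWeight A ≤ k := by
  classical
  have hinj : Function.Injective fun (z : Fin cS → Fin n) j => e (z j) :=
    fun z z' h => funext fun j => he (congrFun h j)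
  rw [minWeight_le_iff, minWeight_le_iff]
  constructor
  · rintro ⟨S', hS', hk⟩
    change Finset (Fin cS → Fin n) at S'
    have hS : (S'.image fun z j => e (z j)).card ≤ k := card_image_le.trans hk
    refine ⟨_, hsuff _ hS fun x => ?_, hS⟩
    refine (holds_pullback (fun z => ?_) x).1 (hS' x)
    exact (hinj.mem_finset_image).symm
  · rintro ⟨S, hS, hk⟩
    have hmem : ∀ z : Fin cS → Fin n, z ∈ univ.filter (fun z => (fun j => e (z j)) ∈ S) ↔
        (fun j => e (z j)) ∈ S := fun z => by simp
    refine ⟨_, fun x => (holds_pullback hmem x).2 (hS _), le_trans ?_ hk⟩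
    exact card_le_card_of_injOn (fun z j => e (z j)) (fun z hz => (hmem z).1 hz) hinj.injOn

/-- The atoms `S(z)` in a clause. -/
def solAtoms (c : List (SLiteral r cS cx)) : List (Fin cS → Fin cx) :=
  c.filterMap fun l => match l.atom with
    | .rel _ _ => none
    | .sol z => some z

theorem mem_solAtoms {c : List (SLiteral r cS cx)} {z : Fin cS → Fin cx} :
    z ∈ solAtoms c ↔ ∃ l ∈ c, l.atom = .sol z := by
  simp only [solAtoms, List.mem_filterMap]
  refine exists_congr fun l => and_congr_right fun _ => ?_
  cases l.atom <;> simp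

theorem length_solAtoms (c : List (SLiteral r cS cx)) :
    (solAtoms c).length = c.countP fun l => l.atom.isSol := by
  unfold solAtoms
  induction c with
  | nil => rfl
  | cons l c ih =>
    rw [List.countP_cons, List.filterMap_cons]
    rcases l with ⟨b, a⟩
    cases a <;> simp [SAtom.isSol, ih]

theorem length_solAtoms_le {ψ : SCNF r cS cx} {c : List (SLiteral r cS cx)} (hc : c ∈ ψ) :
    (solAtoms c).length ≤ ψ.maxOccurrences := by
  rw [length_solAtoms]
  unfold SCNF.maxOccurrences
  induction ψ with
  | nil => simp at hc
  | cons d ψ ih =>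
    rw [List.map_cons, List.foldr_cons]
    rcases List.mem_cons.1 hc with rfl | hc
    · exact le_max_left _ _
    · exact (ih hc).trans (le_max_right _ _)

/-- The tuple that the `j`-th atom `S(z)` of a clause asks for under the assignment `x`. -/
def clauseVal (c : List (SLiteral r cS cx)) (x : List ℕ) (j : Fin (solAtoms c).length) :
    Fin cS → ℕ := fun a => x.getD ((solAtoms c)[j] a) 0

/-- All literals of the clause `c` without `S` are false under the assignment `x`. -/
def active (R : ∀ i, (Fin (r i) → ℕ) → Bool) (c : List (SLiteral r cS cx)) (x : List ℕ) : Bool :=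
  c.all fun l => match l.atom with
    | .rel i z => (R i fun j => x.getD (z j) 0) == l.negated
    | .sol _ => true

/-- A set satisfies a clause if and only if it contains one of the tuples asked for, provided that
the clause is not satisfied anyway. -/
theorem clause_holds_iff {A : FinStruct r} {R : ∀ i, (Fin (r i) → ℕ) → Bool}
    (hR : ∀ i (z : Fin (r i) → Fin A.size), R i (fun j => z j) = decide (z ∈ A.rel i))
    {c : List (SLiteral r cS cx)} (hc : ∀ l ∈ c, l.atom.isSol = true → l.negated = false)
    (S : Finset (Fin cS → Fin A.size)) (x : Fin cx → Fin A.size) :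
    (∃ l ∈ c, SLiteral.Holds A S x l) ↔ (active R c (List.ofFn fun v => (x v : ℕ)) = true →
      ∃ j, clauseVal c (List.ofFn fun v => (x v : ℕ)) j ∈
        S.image fun (z : Fin cS → Fin A.size) a => (z a : ℕ)) := by
  have hinj : Function.Injective fun (z : Fin cS → Fin A.size) a => (z a : ℕ) :=
    fun z z' h => funext fun j => Fin.ext (congrFun h j)
  have hx : ∀ v : Fin cx, (List.ofFn fun v => (x v : ℕ)).getD v 0 = x v := fun v => by simp
  have hval : ∀ j, clauseVal c (List.ofFn fun v => (x v : ℕ)) j =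
      fun a => (((fun a => x ((solAtoms c)[j] a)) a : Fin A.size) : ℕ) :=
    fun j => funext fun a => hx _
  have hmem : (∃ j, clauseVal c (List.ofFn fun v => (x v : ℕ)) j ∈
      S.image fun (z : Fin cS → Fin A.size) a => (z a : ℕ)) ↔
      ∃ z ∈ solAtoms c, (fun a => x (z a)) ∈ S := by
    simp only [hval, hinj.mem_finset_image (s := S)]
    rw [List.exists_mem_iff_getElem]
    exact ⟨fun ⟨j, hj⟩ => ⟨j, j.isLt, hj⟩, fun ⟨j, hj, h⟩ => ⟨⟨j, hj⟩, h⟩⟩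
  have hact : active R c (List.ofFn fun v => (x v : ℕ)) = true ↔
      ∀ l ∈ c, l.atom.isSol = false → ¬ SLiteral.Holds A S x l := by
    unfold active
    rw [List.all_eq_true]
    refine forall₂_congr fun l _ => ?_
    rcases l with ⟨b, a⟩
    cases a with
    | rel i z =>
      have := hR i fun j => x (z j)
      simp only [hx, this, SAtom.isSol, SLiteral.Holds, SAtom.Holds]
      cases b <;> simp
    | sol z => simp [SAtom.isSol]
  rw [hmem, hact]
  constructor
  · rintro ⟨l, hl, h⟩ ha
    rcases hs : l.atom.isSol
    · exact absurd h (ha l hl hs)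
    · have hn := hc l hl hs
      rcases l with ⟨b, a⟩
      cases a with
      | rel i z => simp [SAtom.isSol] at hs
      | sol z =>
        refine ⟨z, mem_solAtoms.2 ⟨_, hl, rfl⟩, ?_⟩
        change b = false at hn
        subst hn
        simpa [SLiteral.Holds, SAtom.Holds] using h
  · intro h
    by_contra! hno
    obtain ⟨z, hz, hS⟩ := h fun l hl _ => hno l hl
    obtain ⟨l, hl, ha⟩ := mem_solAtoms.1 hz
    refine hno l hl ?_
    have hn := hc l hl (by rw [ha]; rfl)
    simpa [SLiteral.Holds, SAtom.Holds, hn, ha] using hS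

variable (ψ : SCNF r cS cx) (R : ∀ i, (Fin (r i) → ℕ) → Bool) (n k : ℕ)

/-- The assignments, over a universe of size `n`, that are chosen for some clause. -/
noncomputable def chosen : List (List ℕ) :=
  ψ.flatMap fun c => Thinning.thin (clauseVal c) k (active R c) (tuples (List.range n) cx)

/-- The elements of the universe that occur in chosen assignments. -/
noncomputable def kept : List ℕ :=
  (List.range n).filter fun a => (chosen ψ R n k).any fun x => x.any fun b => decide (b = a)

variable {ψ R n k}

theorem mem_kept {a : ℕ} : a ∈ kept ψ R n k ↔ a < n ∧ ∃ x ∈ chosen ψ R n k, a ∈ x := by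
  simp [kept]

theorem nodup_kept : (kept ψ R n k).Nodup := List.Nodup.filter _ List.nodup_range

theorem length_of_mem_chosen {x : List ℕ} (h : x ∈ chosen ψ R n k) : x.length = cx := by
  obtain ⟨c, -, hx⟩ := List.mem_flatMap.1 h
  exact (mem_tuples.1 (Thinning.mem_of_mem_thin hx).1).1

theorem exists_length_kept_le (ψ : SCNF r cS cx) : ∃ C, ∀ R n k,
    (kept ψ R n k).length ≤ C * (k + 1) ^ ψ.maxOccurrences := by
  have h1 : ∀ c ∈ ψ, ∃ C, ∀ k, Thinning.capacity k (solAtoms c).length ≤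
      C * (k + 1) ^ ψ.maxOccurrences := by
    intro c hc
    obtain ⟨C, hC⟩ := Thinning.exists_capacity_le (solAtoms c).length
    exact ⟨C, fun k => (hC k).trans (Nat.mul_le_mul_left _
      (Nat.pow_le_pow_right (Nat.succ_pos k) (length_solAtoms_le hc)))⟩
  have h2 : ∀ (φ : List (List (SLiteral r cS cx))), (∀ c ∈ φ, c ∈ ψ) → ∃ C, ∀ R n k,
      (φ.flatMap fun c => Thinning.thin (clauseVal c) k (active R c)
        (tuples (List.range n) cx)).length ≤ C * (k + 1) ^ ψ.maxOccurrences := by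
    intro φ
    induction φ with
    | nil => exact fun _ => ⟨0, fun R n k => by simp⟩
    | cons c φ ih =>
      intro h
      obtain ⟨C, hC⟩ := ih fun d hd => h d (List.mem_cons_of_mem _ hd)
      obtain ⟨C', hC'⟩ := h1 c (h c List.mem_cons_self)
      refine ⟨C' + C, fun R n k => ?_⟩
      rw [List.flatMap_cons, List.length_append, add_mul]
      exact add_le_add ((Thinning.length_thin_le _).trans (hC' k)) (hC R n k)
  obtain ⟨C, hC⟩ := h2 ψ fun c hc => hc
  refine ⟨C * cx, fun R n k => ?_⟩
  have h3 : (kept ψ R n k).length ≤ (chosen ψ R n k).flatten.length :=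
    (nodup_kept.subperm fun a ha => by
      obtain ⟨-, x, hx, hax⟩ := mem_kept.1 ha
      exact List.mem_flatten.2 ⟨x, hx, hax⟩).length_le
  have h4 : (chosen ψ R n k).flatten.length = (chosen ψ R n k).length * cx := by
    rw [List.length_flatten, List.map_congr_left fun x hx => length_of_mem_chosen hx]
    simp
  calc (kept ψ R n k).length ≤ (chosen ψ R n k).length * cx := h4 ▸ h3
    _ ≤ (C * (k + 1) ^ ψ.maxOccurrences) * cx := Nat.mul_le_mul_right _ (hC R n k)
    _ = C * cx * (k + 1) ^ ψ.maxOccurrences := by ring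

/-- The embedding of the kept elements into the universe. -/
noncomputable def keptEmb (ψ : SCNF r cS cx) (R : ∀ i, (Fin (r i) → ℕ) → Bool) (n k : ℕ)
    (a : Fin (kept ψ R n k).length) : Fin n :=
  ⟨(kept ψ R n k)[a], (mem_kept.1 (List.getElem_mem a.isLt)).1⟩

theorem keptEmb_injective : Function.Injective (keptEmb ψ R n k) := by
  intro a b h
  exact Fin.ext ((nodup_kept.getElem_inj_iff).1 (Fin.ext_iff.1 h))

/-- The kept elements contain enough constraints for sets of size at most `k`. -/
theorem models_of_holds_kept (hψ : ψ.PositiveInS) {A : FinStruct r}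
    (hR : ∀ i (z : Fin (r i) → Fin A.size), R i (fun j => z j) = decide (z ∈ A.rel i))
    {S : Finset (Fin cS → Fin A.size)} (hS : S.card ≤ k)
    (h : ∀ x : Fin cx → Fin (kept ψ R A.size k).length,
      ψ.Holds A S fun v => keptEmb ψ R A.size k (x v)) : ψ.Models A S := by
  intro x c hc
  rw [clause_holds_iff hR (hψ c hc)]
  refine Thinning.hits_of_hits_thin (k := k) (l := tuples (List.range A.size) cx)
    (card_image_le.trans hS) (fun y hy => ?_) (mem_tuples.2 ⟨by simp, ?_⟩)
  · -- the entries of a chosen assignment are kept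
    have hy' := Thinning.mem_of_mem_thin hy
    have hlen := (mem_tuples.1 hy'.1).1
    have hch : y ∈ chosen ψ R A.size k := List.mem_flatMap.2 ⟨c, hc, hy⟩
    have hk : ∀ v : Fin cx, ∃ a : Fin (kept ψ R A.size k).length,
        (keptEmb ψ R A.size k a : ℕ) = y[v] := by
      intro v
      have h1 : y[v] ∈ y := List.getElem_mem _
      have h2 := (mem_tuples.1 hy'.1).2 _ h1
      obtain ⟨i, hi, h3⟩ := List.getElem_of_mem
        (mem_kept.2 ⟨List.mem_range.1 h2, y, hch, h1⟩)
      exact ⟨⟨i, hi⟩, h3⟩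
    choose f hf using hk
    have hyf : y = List.ofFn fun v => (keptEmb ψ R A.size k (f v) : ℕ) := by
      apply List.ext_getElem
      · simp [hlen]
      · intro i h1 h2
        rw [List.getElem_ofFn, hf]
        rfl
    have h4 := (clause_holds_iff hR (hψ c hc) S _).1 (h f c hc)
    rw [← hyf] at h4
    exact h4 hy'.2
  · simp

end Semantics

end Kernelization

/-! ### The kernelization is computable in polynomial time -/

namespace StackMachine.PolyFn

open Kernelization

variable {α β : Type} [Coded α] [Coded β]

theorem listSum {ι : Type} (l : List ι) {f : ι → α → ℕ} (hf : ∀ i, PolyFn (f i)) :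
    PolyFn fun a => (l.map fun i => f i a).sum := by
  induction l with
  | nil => simpa using const 0
  | cons i l ih => simpa using (hf i).add ih

theorem beq {f g : α → Bool} (hf : PolyFn f) (hg : PolyFn g) : PolyFn fun a => f a == g a :=
  (congrArg PolyFn (funext fun a => by cases f a <;> cases g a <;> rfl)).mp (ite hf hg hg.not)

theorem decide_eq_bits {l l' : α → List Bool} (hl : PolyFn l) (hl' : PolyFn l') :
    PolyFn fun a => decide (l a = l' a) := by
  -- compare bit by bit, consuming the second list
  let step : Bool × List Bool → Bool → Bool × List Bool := fun s b =>
    match s.2 with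
    | [] => (false, [])
    | c :: u => (s.1 && (c == b), u)
  have hstep : PolyFn fun p : α × ((Bool × List Bool) × Bool) => step p.2.1 p.2.2 :=
    (congrArg PolyFn (funext fun p => by rcases p with ⟨_, ⟨_, _ | _⟩, _⟩ <;> rfl)).mp
      (casesList (l := fun p : α × ((Bool × List Bool) × Bool) => p.2.1.2)
        (g := fun _ => (false, [])) (h := fun p c u => (p.2.1.1 && (c == p.2.2), u))
        snd.fst'.snd' (const _)
        (pair (and fst.snd'.fst'.fst' (beq snd.fst' fst.snd'.snd')) snd.snd'))
  have h := foldl (step := fun _ => step) hl (pair (const true) hl') hstep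
    ⟨_, .const 5, fun a s b _ => by
      rcases s with ⟨ok, _ | ⟨c, u⟩⟩
      · have := size_bool_le false
        simp only [step, size_pair, size_nil]
        omega
      · have := size_bool_le (ok && (c == b))
        simp only [step, size_pair, size_cons]
        omega⟩
  refine (congrArg PolyFn (funext fun a => ?_)).mp (h.fst'.and h.snd'.isEmpty)
  have : ∀ (u v : List Bool) (ok : Bool), ((u.foldl step (ok, v)).1 &&
      (u.foldl step (ok, v)).2.isEmpty) = (ok && decide (u = v)) := by
    intro u
    induction u with
    | nil => intro v ok; cases v <;> simp
    | cons b u ih =>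
      intro v ok
      cases v with
      | nil =>
        have : step (ok, []) b = (false, []) := rfl
        rw [List.foldl_cons, this, ih]
        simp
      | cons c v =>
        have : step (ok, c :: v) b = (ok && (c == b), v) := rfl
        rw [List.foldl_cons, this, ih, Bool.and_assoc]
        cases b <;> cases c <;> simp
  simpa using this (l a) (l' a) true

theorem tuples {l : α → List β} (hl : PolyFn l) (k : ℕ) :
    PolyFn fun a => Kernelization.tuples (l a) k := by
  induction k with
  | zero => exact const [[]]
  | succ k ih =>
    exact flatMap (f := fun a w => (l a).map fun b => b :: w) ih
      (map (f := fun (p : α × List β) b => b :: p.2) (hl.comp fst) (cons snd fst.snd'))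

theorem size_headerStep_le (s : Bool × (ℕ × List Bool)) (b : Bool) :
    size (headerStep s b) ≤ size s + 6 := by
  rcases s with ⟨ph, n, u⟩
  have h1 := size_bool_le true
  have h2 := size_bool_le false
  have h3 := size_bool_le b
  have h4 := one_le_size ph
  have h5 : ∀ (p : Bool) (m : ℕ) (v : List Bool),
      size (p, (m, v)) = size p + (2 * m + 1 + size v + 1) + 1 := fun p m v => by
    rw [size_pair, size_pair, size_nat]
  have h6 : headerStep (ph, (n, u)) b = (true, (n, b :: u)) ∨
      headerStep (ph, (n, u)) b = (true, (n, u)) ∨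
      headerStep (ph, (n, u)) b = (false, (n + 1, u)) := by
    cases ph <;> cases b <;> simp [headerStep]
  rcases h6 with h | h | h <;> rw [h, h5, h5]
  · rw [size_cons]
    omega
  · omega
  · omega

theorem header {w : α → List Bool} (hw : PolyFn w) :
    PolyFn fun a => (w a).foldl headerStep (false, (0, [])) := by
  refine foldl (step := fun _ => headerStep) hw (const _) ?_
    ⟨_, .const 6, fun a s b _ => ?_⟩
  · exact ite snd.fst'.fst' (pair (const true) (pair snd.fst'.snd'.fst' (cons snd.snd'
      snd.fst'.snd'.snd'))) (ite snd.snd' (pair (const true) snd.fst'.snd')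
        (pair (const false) (pair snd.fst'.snd'.fst'.succ snd.fst'.snd'.snd')))
  · exact size_headerStep_le s b

theorem universeSize {w : α → List Bool} (hw : PolyFn w) :
    PolyFn fun a => Kernelization.universeSize (w a) := hw.header.snd'.fst'

theorem body {w : α → List Bool} (hw : PolyFn w) : PolyFn fun a => Kernelization.body (w a) :=
  hw.header.snd'.snd'.reverse

theorem canonical {l : α → List Bool} (hl : PolyFn l) :
    PolyFn fun a => Kernelization.canonical (l a) := hl.reverse.headD true

theorem cappedValue {m : α → ℕ} {l : α → List Bool} (hm : PolyFn m) (hl : PolyFn l) :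
    PolyFn fun a => Kernelization.cappedValue (m a) (l a) := by
  have h := foldl (step := fun a v (b : Bool) => m a - (m a - (2 * v + if b then 1 else 0)))
    hl.reverse (const 0)
    (sub (hm.comp fst) (sub (hm.comp fst) (add (mul (const 2) snd.fst')
      (ite snd.snd' (const 1) (const 0)))))
    ⟨_, hm.polyBdd, fun a s b _ => by simp only [size_nat]; omega⟩
  refine (congrArg PolyFn (funext fun a => ?_)).mp h
  unfold Kernelization.cappedValue
  congr 1
  funext v b
  cases b <;> simp <;> omega

section Instances

variable {t : ℕ} {r : Fin t → ℕ} {cS cx : ℕ} {w : α → List Bool}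

theorem paramBits (hw : PolyFn w) : PolyFn fun a => Kernelization.paramBits r (w a) :=
  drop (listSum _ fun j => hw.universeSize.pow (r j)) hw.body

theorem relations (hw : PolyFn w) (i : Fin t) {z : Fin (r i) → α → ℕ} (hz : ∀ j, PolyFn (z j)) :
    PolyFn fun a => Kernelization.relations r (w a) i fun j => z j a :=
  getD false (add (listSum _ fun j => hw.universeSize.pow (r j))
    (sum _ fun j => (hz j).mul (hw.universeSize.pow j))) hw.body

theorem assemble {l : α → List ℕ} {b : α → List Bool} (hw : PolyFn w) (hl : PolyFn l)
    (hb : PolyFn b) :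
    PolyFn fun a => Kernelization.assemble r (l a) (Kernelization.relations r (w a)) (b a) := by
  have h1 := map (f := fun _ _ => false) hl (const false)
  have h2 : PolyFn fun a => (List.finRange t).flatMap fun i =>
      (Kernelization.tuples (l a) (r i)).map fun z =>
        Kernelization.relations r (w a) i fun j => z.getD j 0 :=
    constFlatMap _ fun i => map (f := fun a (z : List ℕ) =>
      Kernelization.relations r (w a) i fun j => z.getD j 0) (hl.tuples (r i))
        (relations (w := fun p : α × List ℕ => w p.1) (hw.comp fst) i
          fun j => getD 0 (const (j : ℕ)) snd)
  have h := append h1 (cons (const true) (append h2 hb))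
  refine (congrArg PolyFn (funext fun a => ?_)).mp h
  simp [Kernelization.assemble]

theorem valid (hw : PolyFn w) : PolyFn fun a => Kernelization.valid r (w a) :=
  and (decide_eq_bits hw (assemble hw hw.universeSize.range hw.paramBits)) hw.paramBits.canonical

theorem active (c : List (SLiteral r cS cx)) {x : α → List ℕ} (hw : PolyFn w) (hx : PolyFn x) :
    PolyFn fun a => Kernelization.active (Kernelization.relations r (w a)) c (x a) := by
  refine constAll c fun l => ?_
  rcases l with ⟨b, _ | _⟩
  · exact beq (hw.relations _ fun j => getD 0 (const _) hx) (const b)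
  · exact const true

theorem agree (c : List (SLiteral r cS cx)) (P : Finset (Fin (solAtoms c).length)) :
    PolyFn fun p : List ℕ × List ℕ => Thinning.agree (clauseVal c) P p.1 p.2 := by
  have h : PolyFn fun p : List ℕ × List ℕ => P.toList.all fun j => (List.finRange cS).all fun a =>
      decide (p.1.getD ((solAtoms c)[j] a) 0 = p.2.getD ((solAtoms c)[j] a) 0) :=
    constAll _ fun j => constAll _ fun a => decide_eq (getD 0 (const _) fst) (getD 0 (const _) snd)
  refine (congrArg PolyFn (funext fun p => ?_)).mp h
  rw [Bool.eq_iff_iff, Thinning.agree_iff]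
  simp [clauseVal, funext_iff]

theorem kept (ψ : SCNF r cS cx) {n k : α → ℕ} (hw : PolyFn w) (hn : PolyFn n) (hk : PolyFn k) :
    PolyFn fun a => Kernelization.kept ψ (Kernelization.relations r (w a)) (n a) (k a) := by
  have h : PolyFn fun a => chosen ψ (Kernelization.relations r (w a)) (n a) (k a) :=
    constFlatMap ψ fun c => thin hk (act := fun a =>
      Kernelization.active (Kernelization.relations r (w a)) c)
      (active c (w := fun p : α × List ℕ => w p.1) (hw.comp fst) snd) (hn.range.tuples cx) (agree c)
  exact filter (f := fun a b => (chosen ψ (Kernelization.relations r (w a)) (n a) (k a)).any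
    fun x => x.any fun d => decide (d = b)) hn.range
    (any (f := fun (p : α × ℕ) x => x.any fun d => decide (d = p.2)) (h.comp fst)
      (any (f := fun (p : (α × ℕ) × List ℕ) d => decide (d = p.1.2)) snd
        (decide_eq snd fst.fst'.snd')))

end Instances

end StackMachine.PolyFn

/-! ### The kernelization -/

namespace Kernelization

open StackMachine

section

variable {t : ℕ} {r : Fin t → ℕ} {cS cx : ℕ}

theorem models_of_maxOccurrences_eq_zero {ψ : SCNF r cS cx} (h : ψ.maxOccurrences = 0)
    {A : FinStruct r} {S : Finset (Fin cS → Fin A.size)} (hS : ψ.Models A S)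
    (S' : Finset (Fin cS → Fin A.size)) : ψ.Models A S' := by
  intro x c hc
  obtain ⟨l, hl, hh⟩ := hS x c hc
  refine ⟨l, hl, ?_⟩
  have h0 := length_solAtoms_le hc
  rw [h, length_solAtoms, Nat.le_zero, List.countP_eq_zero] at h0
  have h1 := h0 l hl
  rcases l with ⟨b, _ | _⟩
  · exact hh
  · exact absurd rfl h1

/-- Without occurrences of `S`, the optimum is zero or infinite. -/
theorem minWeight_le_iff_of_maxOccurrences_eq_zero {ψ : SCNF r cS cx} (h : ψ.maxOccurrences = 0)
    (A : FinStruct r) (k : ℕ) : ψ.minWeight A ≤ k ↔ ψ.minWeight A ≤ (0 : ℕ) := by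
  rw [minWeight_le_iff, minWeight_le_iff]
  constructor
  · rintro ⟨S, hS, -⟩
    exact ⟨∅, models_of_maxOccurrences_eq_zero h hS ∅, le_rfl⟩
  · rintro ⟨S, hS, hk⟩
    exact ⟨S, hS, hk.trans (Nat.zero_le k)⟩

/-- The elements of the universe that the kernelization retains. The parameter is cut off at the
number of all tuples, so that it can be written in unary. -/
noncomputable def kernelUniverse (ψ : SCNF r cS cx) (w : List Bool) : List ℕ :=
  kept ψ (relations r w) (universeSize w) (cappedValue (universeSize w ^ cS) (paramBits r w))

/-- The kernelization: restrict the structure to the retained elements. Strings that encode no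
instance are mapped to the empty string, which encodes none either. If `S` does not occur in the
formula, then the parameter is irrelevant and replaced by zero. -/
noncomputable def kernel (ψ : SCNF r cS cx) (w : List Bool) : List Bool :=
  if valid r w then assemble r (kernelUniverse ψ w) (relations r w)
    (if ψ.maxOccurrences = 0 then [] else paramBits r w)
  else []

theorem polyFn_kernel (ψ : SCNF r cS cx) : PolyFn (kernel ψ) := by
  have hU : PolyFn (kernelUniverse ψ) :=
    PolyFn.kept ψ .id (.universeSize .id) (.cappedValue ((PolyFn.universeSize .id).pow cS)
      (.paramBits .id))
  refine PolyFn.ite (.valid .id) (.assemble .id hU ?_) (.const [])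
  split
  · exact .const []
  · exact .paramBits .id

/-- The kernel of an instance is the code of the induced substructure. -/
theorem kernel_eq_encode (ψ : SCNF r cS cx) {w : List Bool} (h : valid r w = true) :
    kernel ψ w = (pullback (decode r w) (keptEmb ψ (relations r w) (universeSize w)
      (cappedValue (universeSize w ^ cS) (paramBits r w)))).encode
        (if ψ.maxOccurrences = 0 then 0 else value (paramBits r w)) := by
  have hb : (if ψ.maxOccurrences = 0 then [] else paramBits r w) =
      (if ψ.maxOccurrences = 0 then 0 else value (paramBits r w)).bits := by
    split
    · rw [Nat.zero_bits]
    · rw [valid, Bool.and_eq_true] at h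
      rw [bits_value h.2]
  unfold kernel
  rw [if_pos h, hb]
  refine assemble_eq_encode _ rfl (fun i z => ?_) _
  rw [Bool.eq_iff_iff, decide_eq_true_iff]
  exact Iff.trans (by rfl) (mem_rel_decode.symm.trans mem_rel_pullback.symm)

theorem minWeight_kernel_le_iff {ψ : SCNF r cS cx} (hψ : ψ.PositiveInS) (w : List Bool) (k : ℕ)
    (hk : value (paramBits r w) = k) :
    ψ.minWeight (pullback (decode r w) (keptEmb ψ (relations r w) (universeSize w)
      (cappedValue (universeSize w ^ cS) (paramBits r w)))) ≤ k ↔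
      ψ.minWeight (decode r w) ≤ k := by
  refine minWeight_pullback_le_iff keptEmb_injective fun S hS hx => ?_
  refine models_of_holds_kept hψ (R := relations r w)
    (k := cappedValue (universeSize w ^ cS) (paramBits r w)) (fun i z => ?_) ?_ hx
  · rw [Bool.eq_iff_iff, decide_eq_true_iff]
    exact mem_rel_decode.symm
  · rw [cappedValue_eq, hk]
    refine le_min ((Finset.card_le_univ S).trans (le_of_eq ?_)) hS
    rw [Fintype.card_fun, Fintype.card_fin, Fintype.card_fin]
    rfl

theorem length_bits_le (k : ℕ) : k.bits.length ≤ k + 1 := by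
  rw [Nat.size_eq_bits_len]
  exact Nat.size_le.2 (Nat.lt_two_pow_self.trans (Nat.pow_lt_pow_right one_lt_two k.lt_succ_self))

/-- The universe of the kernel has size `O((k + 1) ^ s)`, its tables are at most `m`-th powers of
that, and the parameter is only written down if `s` is positive. -/
theorem exists_length_kernel_le (ψ : SCNF r cS cx) : ∃ c, ∀ w, valid r w = true →
    (kernel ψ w).length ≤
      c * (value (paramBits r w) + 1) ^ (ψ.maxOccurrences * max (Finset.univ.sup r) 1) := by
  obtain ⟨C, hC⟩ := exists_length_kept_le ψ
  set s := ψ.maxOccurrences with hs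
  set m := max (Finset.univ.sup r) 1 with hm
  refine ⟨(C + 1) ^ m + 1 + t * (C + 1) ^ m + 1, fun w hw => ?_⟩
  set k := value (paramBits r w) with hk
  have h1 : (kernelUniverse ψ w).length ≤ (C + 1) * (k + 1) ^ s := by
    refine (hC _ _ _).trans (Nat.mul_le_mul (Nat.le_succ C) (Nat.pow_le_pow_left ?_ s))
    rw [cappedValue_eq]
    exact Nat.succ_le_succ (min_le_right _ _)
  have hpow : ((C + 1) * (k + 1) ^ s) ^ m = (C + 1) ^ m * (k + 1) ^ (s * m) := by
    rw [mul_pow, ← pow_mul]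
  have h2 : ∀ d ≤ m, (kernelUniverse ψ w).length ^ d ≤ (C + 1) ^ m * (k + 1) ^ (s * m) := by
    intro d hd
    rw [← hpow]
    exact (Nat.pow_le_pow_left h1 d).trans (Nat.pow_le_pow_right (by positivity) hd)
  have h3 : (kernelUniverse ψ w).length ≤ (C + 1) ^ m * (k + 1) ^ (s * m) := by
    simpa using h2 1 (le_max_right _ _)
  have h4 : ((List.finRange t).flatMap fun i => (tuples (kernelUniverse ψ w) (r i)).map fun z =>
      relations r w i fun j => z.getD j 0).length ≤ t * ((C + 1) ^ m * (k + 1) ^ (s * m)) := by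
    rw [List.length_flatMap]
    refine (List.sum_le_card_nsmul _ ((C + 1) ^ m * (k + 1) ^ (s * m)) ?_).trans
      (le_of_eq (by simp))
    intro x hx
    obtain ⟨i, -, rfl⟩ := List.mem_map.1 hx
    rw [List.length_map, length_tuples]
    exact h2 _ ((Finset.le_sup (Finset.mem_univ i)).trans (le_max_left _ _))
  have h5 : (if s = 0 then [] else paramBits r w).length ≤ (k + 1) ^ (s * m) := by
    split
    · exact Nat.zero_le _
    · rename_i hs0
      rw [valid, Bool.and_eq_true] at hw
      rw [← bits_value hw.2]
      refine (length_bits_le _).trans (Nat.le_self_pow ?_ _)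
      exact Nat.mul_ne_zero hs0 (by omega)
  have h6 : 1 ≤ (k + 1) ^ (s * m) := Nat.one_le_pow _ _ (Nat.succ_pos k)
  unfold kernel assemble
  rw [if_pos hw, List.length_append, List.length_cons, List.length_append, List.length_replicate]
  calc _ ≤ (C + 1) ^ m * (k + 1) ^ (s * m) + (t * ((C + 1) ^ m * (k + 1) ^ (s * m)) +
        (k + 1) ^ (s * m) + (k + 1) ^ (s * m)) :=
        add_le_add h3 (add_le_add (add_le_add h4 h5) h6)
    _ = _ := by ring

end

section Problem

variable {t : ℕ} {r : Fin t → ℕ} (Q : MinimizationProblem r)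

theorem param_eq (w : List Bool) : Q.standardParameterization.param w =
    if valid r w then value (paramBits r w) else 0 := by
  by_cases h : valid r w = true
  · rw [if_pos h]
    conv_lhs => rw [← encode_decode h]
    exact Q.param_encode _ _
  · rw [if_neg h]
    refine dif_neg ?_
    rintro ⟨I, rfl⟩
    exact h (valid_encode I.1 I.2)

theorem hasPolyTimeParameter : Q.standardParameterization.HasPolyTimeParameter := by
  refine PolyFn.computableInPolyTime ?_
  refine (congrArg PolyFn (funext fun w => ?_)).mp
    (PolyFn.ite (.valid (r := r) .id) (.paramBits (r := r) .id) (.const []))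
  rw [param_eq]
  split
  · rename_i h
    rw [valid, Bool.and_eq_true] at h
    rw [bits_value h.2]
  · rw [Nat.zero_bits]

theorem valid_of_mem_lang {w : List Bool} (h : w ∈ Q.standardParameterization.lang) :
    valid r w = true := by
  obtain ⟨A, k, rfl, -⟩ := h
  exact valid_encode A k

variable {Q} {cS cx : ℕ} {ψ : SCNF r cS cx}

theorem mem_lang_iff_kernel_mem_lang (hψ : ψ.Expresses Q) (w : List Bool) :
    w ∈ Q.standardParameterization.lang ↔ kernel ψ w ∈ Q.standardParameterization.lang := by
  by_cases h : valid r w = true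
  · rw [kernel_eq_encode ψ h, Q.encode_mem_lang, hψ.2]
    conv_lhs => rw [← encode_decode h]
    rw [Q.encode_mem_lang, hψ.2, ← minWeight_kernel_le_iff hψ.1 w _ rfl]
    split
    · rename_i hs
      exact minWeight_le_iff_of_maxOccurrences_eq_zero hs _ _
    · rfl
  · refine iff_of_false (fun hw => h (valid_of_mem_lang Q hw)) ?_
    rw [kernel, if_neg h]
    rintro ⟨A, k, hA, -⟩
    simp [FinStruct.encode] at hA

theorem exists_isKernelization (hψ : ψ.Expresses Q) : ∃ c : ℕ,
    Q.standardParameterization.IsKernelization (kernel ψ) fun k =>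
      c * (k + 1) ^ (ψ.maxOccurrences * max (Finset.univ.sup r) 1) := by
  obtain ⟨c, hc⟩ := exists_length_kernel_le ψ
  refine ⟨c, PolyFn.computableInPolyTime (eb := id) (polyFn_kernel ψ), fun w =>
    ⟨mem_lang_iff_kernel_mem_lang hψ w, ?_⟩⟩
  rw [param_eq]
  by_cases h : valid r w = true
  · rw [if_pos h]
    exact hc w h
  · rw [kernel, if_neg h]
    exact Nat.zero_le _

end Problem

end Kernelization

theorem mainTheorem1 {t : ℕ} (r : Fin t → ℕ) (Q : MinimizationProblem r)
    (hQ : Q ∈ MinFPlusPi1 r) :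
    Q.standardParameterization.HasPolyTimeParameter ∧
    Q.standardParameterization.AdmitsPolynomialKernelization ∧
    ∀ (cS cx : ℕ) (ψ : SCNF r cS cx), ψ.Expresses Q →
      ∃ (c : ℕ) (K : List Bool → List Bool),
        Q.standardParameterization.IsKernelization K fun k =>
          c * (k + 1) ^ (ψ.maxOccurrences * max (Finset.univ.sup r) 1) := by
  refine ⟨Kernelization.hasPolyTimeParameter Q, ?_, fun cS cx ψ hψ => ?_⟩
  · obtain ⟨cS, cx, ψ, hψ⟩ := hQ
    obtain ⟨c, hc⟩ := Kernelization.exists_isKernelization hψ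
    refine ⟨Kernelization.kernel ψ, Polynomial.C c *
      (Polynomial.X + 1) ^ (ψ.maxOccurrences * max (Finset.univ.sup r) 1), ?_⟩
    simpa using hc
  · obtain ⟨c, hc⟩ := Kernelization.exists_isKernelization hψ
    exact ⟨c, _, hc⟩
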